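/- For a prime $p$ let $\mathbb F_p$ be the field of residue classes modulo $p$ and $\mathbb F_p^*=\mathbb F_p\setminus\{0\}$. A set $\mathcal I\subset\mathbb F_p$ is called an interval if $\mathcal I=\{L+1,\ldots,L+N\} \pmod p$ for some integers $L$ and $N\ge 1$. For $\mathcal A,\mathcal B\subset\mathbb F_p$ and $\xi\in\mathbb F_p$ write $\mathcal A+\mathcal B=\{a+b:\ a\in\mathcal A,\ b\in\mathcal B\}$, $\mathcal A\mathcal B=\{ab:\ a\in\mathcal A,\ b\in\mathcal B\}$ and $\xi\mathcal A=\{\xi a:\ a\in\mathcal A\}$. Theorem. For any $\varepsilon>0$ there exists $\delta=\delta(\varepsilon)>0$ such that the following holds for any sufficiently large prime $p$ (that is, for every prime $p\ge p_0$, where $p_0$ depends only on $\varepsilon$): let $\mathcal I_1,\mathcal I_2,\ldots,\mathcal I_{13}\subset\mathbb F_p^*$ be intervals with $1 \pmod p\in\mathcal I_{13}$ and $$|\mathcal I_i|>p^{1/4-\delta},\quad i=1,2,\ldots,12;\qquad |\mathcal I_{13}|>p^{\varepsilon}.$$ Then for any $a,b,c\in\mathbb F_p^*$ we have $$c\in a\prod_{i=1}^{6}\mathcal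 I_i+b\prod_{i=7}^{13}\mathcal I_i.$$ -/

import Mathlib

open scoped Pointwise

/-- A set of residue classes modulo `p` is an interval if it is the reduction modulo `p` of
`{L + 1, …, L + N}` for some integers `L` and `N ≥ 1`. -/
def IsResidueInterval (p : ℕ) (I : Set (ZMod p)) : Prop :=
  ∃ L N : ℤ, 1 ≤ N ∧ I = (fun n : ℤ => (n : ZMod p)) '' Set.Icc (L + 1) (L + N)

/-!
Put `H = p ^ (1 / 4 - o(1))`. Six of the intervals multiply to `X₁ X₂` and seven to `X₃ X₄`, where
`X₁, X₂, X₃` are products of three intervals and `X₄ = Y J` is a product `Y` of three intervals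
times the interval `J = I 13`. By a second moment count of the points of `X₁ × X₃` on the lines
`a m x + b n y = c`, the equation `a x₁ x₂ + b x₃ x₄ = c` is solvable as soon as
`|X₁| |X₂| |X₃| |X₄| > p³` (`exists_bilinear_eq`). So it is enough that a product of three intervals
has `p ^ (3 / 4 - o(1))` elements and that multiplication by `J` gains a fixed power of `p`.

*Three intervals.* By Cauchy–Schwarz the product set is large if the multiplicative energy of the
three intervals is `H ^ (3 + o(1))`. Written as a mean over Dirichlet characters, this energy is at
most the mean of the energies with all three intervals equal (`productEnergy_le_mean`). So one has
to count the solutions of `∏ (L + s i) ≡ ∏ (L + t i)` modulo `p` with `s i, t i ∈ [1, H]`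
(`card_tripleSolutions_le`). The difference `∏ (X + s i) - ∏ (X + t i)` is a polynomial
`α X² + β X + γ` with coefficients `O(H)`, `O(H²)`, `O(H³)` and the root `L` modulo `p`.

* A nonzero polynomial arises from only `H ^ (1 + o(1))` pairs of triples, by the divisor bound
  applied to its values at the `-t j` (`card_coeffDiff_eq_le`).
* Only `O(H²)` polynomials occur. By Dirichlet's approximation theorem `L ≡ u / v` with
  `U = max |u| (H v) ≤ H³`. If `U ≥ H²`, then for fixed `α` the integers `β u + γ v` lie in one
  residue class modulo `p`; this leaves `O(U / H²)` values, each taken `O(H³ / U)` times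
  (`card_small_polys_le_of_large`). If `U ≤ H²`, then `α u² + β u v + γ v²` is a multiple of `p` of
  size `O(H U²)`; this leaves `O(H U² / p)` nonzero values, each taken `O(H⁵ / U²)` times
  (`card_small_polys_le_of_small`).
* If `α u² + β u v + γ v² = 0`, then `∏ (u + v s i) = ∏ (u + v t i)` holds in the integers, and
  the divisor bound gives `H ^ (3 + o(1))` solutions (`card_integer_solutions_le`).

*The short interval.* As `1 ∈ J` and `0 ∉ J`, the set `J` contains the residues `1, …, M` for some
`M` of size about `p ^ (1 / k)`, where `k` depends only on `ε`. Their `k`-fold products are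
determined as integers, so that the `k`-fold product set of `J` has `p ^ (1 - o(1))` elements
(`pow_le_card_pow`), and Plünnecke's inequality turns this into
`|Y J| ≥ p ^ (3 / 4 + 1 / (4 k) - o(1))` (`card_pow_mul_le_card_mul_pow`).
-/

/-! ### Divisor bounds -/

/-- The number of divisors of `n` is `O(n ^ e)` for every `e > 0`: prime powers `q ^ a ∥ n` with
`q ≥ 2 ^ (1 / e)` contribute at most `q ^ (a * e)`, and each of the remaining, boundedly many,
primes costs a constant factor. -/
lemma exists_card_divisors_le (e : ℝ) (he : 0 < e) :
    ∃ C : ℝ, 1 ≤ C ∧ ∀ n : ℕ, n ≠ 0 → (n.divisors.card : ℝ) ≤ C * (n : ℝ) ^ e := by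
  set B : ℕ := ⌈(2 : ℝ) ^ (1 / e)⌉₊ with hB
  set K : ℝ := 1 + 2 / e with hK
  have hK1 : 1 ≤ K := by rw [hK]; have : 0 < 2 / e := by positivity
                         linarith
  refine ⟨K ^ B, one_le_pow₀ hK1, fun n hn => ?_⟩
  rw [Nat.card_divisors hn]
  have hn' : (n : ℝ) ^ e = ∏ q ∈ n.primeFactors, ((q : ℝ) ^ e) ^ (n.factorization q) := by
    conv_lhs => rw [← Nat.prod_factorization_pow_eq_self hn]
    rw [Finsupp.prod, Nat.support_factorization]
    push_cast
    rw [← Real.finsetProd_rpow _ _ (fun i _ => by positivity)]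
    refine Finset.prod_congr rfl fun q _ => ?_
    rw [← Real.rpow_natCast, ← Real.rpow_natCast, ← Real.rpow_mul (by positivity),
      ← Real.rpow_mul (by positivity), mul_comm]
  rw [hn']
  push_cast
  have key : ∀ q ∈ n.primeFactors, ((n.factorization q : ℝ) + 1) ≤
      (if q < B then K else 1) * ((q : ℝ) ^ e) ^ (n.factorization q) := by
    intro q hq
    have hq2 : (2 : ℝ) ≤ q := by exact_mod_cast (Nat.prime_of_mem_primeFactors hq).two_le
    set a := n.factorization q
    split_ifs with h
    · have h1 : 1 + e / 2 ≤ (q : ℝ) ^ e := by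
        have h2 : (2 : ℝ) ^ e ≤ (q : ℝ) ^ e := Real.rpow_le_rpow (by norm_num) hq2 he.le
        have h3 : Real.log 2 * e + 1 ≤ (2 : ℝ) ^ e := by
          rw [Real.rpow_def_of_pos (by norm_num)]
          exact Real.add_one_le_exp _
        have := Real.log_two_gt_d9
        nlinarith
      have h2 : 1 + (a : ℝ) * (e / 2) ≤ ((q : ℝ) ^ e) ^ a :=
        le_trans (one_add_mul_le_pow (by linarith) a) (pow_le_pow_left₀ (by positivity) h1 a)
      calc (a : ℝ) + 1 ≤ K * (1 + (a : ℝ) * (e / 2)) := by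
            rw [hK]
            have : (1 + 2 / e) * (1 + (a : ℝ) * (e / 2)) = 1 + a + (2 / e + a * e / 2) := by
              field_simp
              ring
            rw [this]
            have : 0 ≤ 2 / e + a * e / 2 := by positivity
            linarith
        _ ≤ _ := by gcongr
    · rw [one_mul]
      have h1 : (2 : ℝ) ≤ (q : ℝ) ^ e := by
        have h2 : (2 : ℝ) ^ (1 / e) ≤ q := (Nat.le_ceil _).trans (by exact_mod_cast not_lt.1 h)
        calc (2 : ℝ) = ((2 : ℝ) ^ (1 / e)) ^ e := by
              rw [← Real.rpow_mul (by norm_num), one_div_mul_cancel he.ne', Real.rpow_one]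
          _ ≤ _ := Real.rpow_le_rpow (by positivity) h2 he.le
      calc (a : ℝ) + 1 ≤ 2 ^ a := by exact_mod_cast Nat.lt_two_pow_self
        _ ≤ _ := pow_le_pow_left₀ (by norm_num) h1 a
  refine (Finset.prod_le_prod (fun i _ => by positivity) key).trans ?_
  rw [Finset.prod_mul_distrib]
  refine mul_le_mul_of_nonneg_right ?_ (by positivity)
  rw [← Finset.prod_filter, Finset.prod_const]
  refine pow_le_pow_right₀ hK1 ?_
  refine (Finset.card_le_card (t := Finset.range B) fun q hq => ?_).trans (by simp)
  simpa using (Finset.mem_filter.1 hq).2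

/-- `D` bounds the number of divisors of every integer in `[1, N]`. -/
def DivisorBound (N D : ℕ) : Prop := ∀ n : ℕ, n ≠ 0 → n ≤ N → n.divisors.card ≤ D

lemma DivisorBound.mono {N M D : ℕ} (h : DivisorBound N D) (hM : M ≤ N) : DivisorBound M D :=
  fun n hn hnM => h n hn (hnM.trans hM)

lemma DivisorBound.one_le {N D : ℕ} (h : DivisorBound N D) (hN : 1 ≤ N) : 1 ≤ D := by
  simpa using h 1 one_ne_zero hN

lemma DivisorBound.exists_int {N D : ℕ} (h : DivisorBound N D) (n : ℤ) (hn : n ≠ 0)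
    (hN : n.natAbs ≤ N) : ∃ S : Finset ℤ, S.card ≤ 2 * D ∧ ∀ x : ℤ, x ∣ n → x ∈ S := by
  refine ⟨n.natAbs.divisors.image (fun d : ℕ => (d : ℤ)) ∪
    n.natAbs.divisors.image (fun d : ℕ => -(d : ℤ)), ?_, fun x hx => ?_⟩
  · have h0 := h n.natAbs (Int.natAbs_ne_zero.2 hn) hN
    have h1 := Finset.card_union_le (n.natAbs.divisors.image (fun d : ℕ => (d : ℤ)))
      (n.natAbs.divisors.image (fun d : ℕ => -(d : ℤ)))
    have h2 := Finset.card_image_le (s := n.natAbs.divisors) (f := fun d : ℕ => (d : ℤ))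
    have h3 := Finset.card_image_le (s := n.natAbs.divisors) (f := fun d : ℕ => -(d : ℤ))
    omega
  · have hd : x.natAbs ∈ n.natAbs.divisors :=
      Nat.mem_divisors.2 ⟨Int.natAbs_dvd_natAbs.2 hx, Int.natAbs_ne_zero.2 hn⟩
    rw [Finset.mem_union, Finset.mem_image, Finset.mem_image]
    rcases Int.natAbs_eq x with hx | hx
    · exact Or.inl ⟨_, hd, hx.symm⟩
    · exact Or.inr ⟨_, hd, hx.symm⟩

/-! ### Pairs of triples with prescribed differences of symmetric functions -/

/-- The first elementary symmetric function of a triple. -/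
def esymm₁ (s : Fin 3 → ℤ) : ℤ := s 0 + s 1 + s 2

/-- The second elementary symmetric function of a triple. -/
def esymm₂ (s : Fin 3 → ℤ) : ℤ := s 0 * s 1 + s 0 * s 2 + s 1 * s 2

/-- The third elementary symmetric function of a triple. -/
def esymm₃ (s : Fin 3 → ℤ) : ℤ := s 0 * s 1 * s 2

/-- The coefficients `(α, β, γ)` of `∏ (X + s i) - ∏ (X + t i) = α X² + β X + γ`. -/
def coeffDiff (x : (Fin 3 → ℤ) × (Fin 3 → ℤ)) : ℤ × ℤ × ℤ :=
  (esymm₁ x.1 - esymm₁ x.2, esymm₂ x.1 - esymm₂ x.2, esymm₃ x.1 - esymm₃ x.2)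

/-- The triples of integers in `[1, H]`. -/
noncomputable def tripleBox (H : ℕ) : Finset (Fin 3 → ℤ) :=
  Fintype.piFinset fun _ => Finset.Icc (1 : ℤ) H

lemma mem_tripleBox {H : ℕ} {s : Fin 3 → ℤ} :
    s ∈ tripleBox H ↔ ∀ i, 1 ≤ s i ∧ s i ≤ H := by
  simp [tripleBox]

lemma card_tripleBox (H : ℕ) : (tripleBox H).card = H ^ 3 := by
  simp [tripleBox]

lemma card_filter_esymm_le (A : Finset (Fin 3 → ℤ)) (c₁ c₂ c₃ : ℤ) :
    (A.filter fun s => esymm₁ s = c₁ ∧ esymm₂ s = c₂ ∧ esymm₃ s = c₃).card ≤ 27 := by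
  by_cases h : ∃ s, esymm₁ s = c₁ ∧ esymm₂ s = c₂ ∧ esymm₃ s = c₃
  · obtain ⟨r, h1, h2, h3⟩ := h
    have hR : ({r 0, r 1, r 2} : Finset ℤ).card ≤ 3 := Finset.card_le_three
    refine (Finset.card_le_card
      (t := Fintype.piFinset fun _ => ({r 0, r 1, r 2} : Finset ℤ)) fun s hs => ?_).trans ?_
    · obtain ⟨-, g1, g2, g3⟩ := Finset.mem_filter.1 hs
      rw [Fintype.mem_piFinset]
      intro i
      have key : (s i - r 0) * (s i - r 1) * (s i - r 2) = 0 := by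
        have : (s i - r 0) * (s i - r 1) * (s i - r 2) =
            s i ^ 3 - esymm₁ r * s i ^ 2 + esymm₂ r * s i - esymm₃ r := by
          simp only [esymm₁, esymm₂, esymm₃]; ring
        rw [this, h1, h2, h3, ← g1, ← g2, ← g3]
        fin_cases i <;> simp [esymm₁, esymm₂, esymm₃] <;> ring
      simp only [Finset.mem_insert, Finset.mem_singleton]
      rcases mul_eq_zero.1 key with hk | hk
      · rcases mul_eq_zero.1 hk with hk | hk
        · exact Or.inl (sub_eq_zero.1 hk)
        · exact Or.inr (Or.inl (sub_eq_zero.1 hk))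
      · exact Or.inr (Or.inr (sub_eq_zero.1 hk))
    · rw [Fintype.card_piFinset_const]
      exact Nat.pow_le_pow_left hR 3
  · rw [Finset.filter_false_of_mem fun s _ hs => h ⟨s, hs⟩]
    simp

lemma exists_quadratic_roots (a b c : ℤ) (h : (a, b, c) ≠ 0) :
    ∃ R : Finset ℤ, R.card ≤ 2 ∧ ∀ x : ℤ, a * x ^ 2 - b * x + c = 0 → x ∈ R := by
  classical
  set P : Polynomial ℤ := Polynomial.C a * Polynomial.X ^ 2 + Polynomial.C (-b) * Polynomial.X +
    Polynomial.C c with hP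
  have hP0 : P ≠ 0 := by
    intro h0
    apply h
    have h2 : P.coeff 2 = 0 := by rw [h0]; simp
    have h1 : P.coeff 1 = 0 := by rw [h0]; simp
    have hc : P.coeff 0 = 0 := by rw [h0]; simp
    rw [hP] at h2 h1 hc
    simp [Polynomial.coeff_X, Polynomial.coeff_C, -eq_intCast] at h2 h1 hc
    simp [h1, h2, hc]
  refine ⟨P.roots.toFinset, ?_, fun x hx => ?_⟩
  · exact (Multiset.toFinset_card_le _).trans
      ((Polynomial.card_roots' P).trans Polynomial.natDegree_quadratic_le)
  · rw [Multiset.mem_toFinset, Polynomial.mem_roots hP0, Polynomial.IsRoot, hP]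
    simp
    linarith

/-- The first triple and the value of `coeffDiff` fix the elementary symmetric functions of the
second triple, hence its entries up to order. -/
lemma card_filter_fst_le (A : Finset ((Fin 3 → ℤ) × (Fin 3 → ℤ))) (c : ℤ × ℤ × ℤ)
    (hA : ∀ x ∈ A, coeffDiff x = c) (s : Fin 3 → ℤ) :
    (A.filter fun x => x.1 = s).card ≤ 27 := by
  classical
  set F := A.filter fun x => x.1 = s with hF
  have hmem : ∀ r ∈ F.image Prod.snd, esymm₁ r = esymm₁ s - c.1 ∧
      esymm₂ r = esymm₂ s - c.2.1 ∧ esymm₃ r = esymm₃ s - c.2.2 := by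
    intro r hr
    obtain ⟨x, hx, rfl⟩ := Finset.mem_image.1 hr
    obtain ⟨hxA, rfl⟩ := Finset.mem_filter.1 hx
    rw [← hA x hxA]
    simp [coeffDiff]
  have := card_filter_esymm_le (F.image Prod.snd) (esymm₁ s - c.1) (esymm₂ s - c.2.1)
    (esymm₃ s - c.2.2)
  rw [Finset.filter_true_of_mem hmem, Finset.card_image_of_injOn] at this
  · exact this
  · intro x hx y hy hxy
    rw [Finset.mem_coe, hF, Finset.mem_filter] at hx hy
    exact Prod.ext (hx.2.trans hy.2.symm) (hxy)

lemma card_filter_snd_le (A : Finset ((Fin 3 → ℤ) × (Fin 3 → ℤ))) (c : ℤ × ℤ × ℤ)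
    (hA : ∀ x ∈ A, coeffDiff x = c) (t : Fin 3 → ℤ) :
    (A.filter fun x => x.2 = t).card ≤ 27 := by
  classical
  set F := A.filter fun x => x.2 = t with hF
  have hmem : ∀ r ∈ F.image Prod.fst, esymm₁ r = esymm₁ t + c.1 ∧
      esymm₂ r = esymm₂ t + c.2.1 ∧ esymm₃ r = esymm₃ t + c.2.2 := by
    intro r hr
    obtain ⟨x, hx, rfl⟩ := Finset.mem_image.1 hr
    obtain ⟨hxA, rfl⟩ := Finset.mem_filter.1 hx
    rw [← hA x hxA]
    simp [coeffDiff]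
  have := card_filter_esymm_le (F.image Prod.fst) (esymm₁ t + c.1) (esymm₂ t + c.2.1)
    (esymm₃ t + c.2.2)
  rw [Finset.filter_true_of_mem hmem, Finset.card_image_of_injOn] at this
  · exact this
  · intro x hx y hy hxy
    rw [Finset.mem_coe, hF, Finset.mem_filter] at hx hy
    exact Prod.ext (hxy) (hx.2.trans hy.2.symm)

/-- For `X = -t j` the identity `∏ (X + s i) - ∏ (X + t i) = α X² + β X + γ` reads
`∏ (s i - t j) = α (t j)² - β (t j) + γ`. -/
lemma prod_sub_eq_of_coeffDiff {x : (Fin 3 → ℤ) × (Fin 3 → ℤ)} {c : ℤ × ℤ × ℤ}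
    (h : coeffDiff x = c) (j : Fin 3) :
    (x.1 0 - x.2 j) * (x.1 1 - x.2 j) * (x.1 2 - x.2 j) =
      c.1 * x.2 j ^ 2 - c.2.1 * x.2 j + c.2.2 := by
  subst h
  fin_cases j <;> simp [coeffDiff, esymm₁, esymm₂, esymm₃] <;> ring

/-- If `q = α X² - β X + γ` does not vanish at `t j`, then `t j` determines, up to divisors of
`q (t j)`, all the `s i`. -/
lemma card_filter_eval_ne_zero_le {H D : ℕ} (hD : DivisorBound (H ^ 3) D)
    (A : Finset ((Fin 3 → ℤ) × (Fin 3 → ℤ))) (c : ℤ × ℤ × ℤ) (hA : ∀ x ∈ A, coeffDiff x = c)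
    (hbox : ∀ x ∈ A, ∀ i, (1 ≤ x.1 i ∧ x.1 i ≤ H) ∧ (1 ≤ x.2 i ∧ x.2 i ≤ H)) (j : Fin 3)
    (hne : ∀ x ∈ A, c.1 * x.2 j ^ 2 - c.2.1 * x.2 j + c.2.2 ≠ 0) :
    A.card ≤ 27 * (2 * D) ^ 3 * H := by
  classical
  have := Finset.card_le_mul_card_image_of_maps_to (s := A)
    (t := Finset.Icc (1 : ℤ) H) (f := fun x => x.2 j)
    (fun x hx => Finset.mem_Icc.2 (hbox x hx j).2) (27 * (2 * D) ^ 3) ?_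
  · simpa using this
  intro τ _
  set F := A.filter fun x => x.2 j = τ with hF
  have hFm : ∀ x ∈ F, x ∈ A ∧ x.2 j = τ := fun x hx => Finset.mem_filter.1 hx
  rcases F.eq_empty_or_nonempty with h0 | ⟨y, hy⟩
  · simp [h0]
  obtain ⟨n, hn⟩ : ∃ n, n = c.1 * τ ^ 2 - c.2.1 * τ + c.2.2 := ⟨_, rfl⟩
  have hn0 : n ≠ 0 := by
    have := hne y (hFm y hy).1
    rwa [(hFm y hy).2, ← hn] at this
  have hprod : ∀ x ∈ F, (x.1 0 - τ) * (x.1 1 - τ) * (x.1 2 - τ) = n := by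
    intro x hx
    have := prod_sub_eq_of_coeffDiff (hA x (hFm x hx).1) j
    rwa [(hFm x hx).2, ← hn] at this
  have hle : n.natAbs ≤ H ^ 3 := by
    rw [← hprod y hy, Int.natAbs_mul, Int.natAbs_mul, pow_three']
    have hb : ∀ i, (y.1 i - τ).natAbs ≤ H := by
      intro i
      have h1 := hbox y (hFm y hy).1 i
      have h2 := (hbox y (hFm y hy).1 j).2
      rw [(hFm y hy).2] at h2
      omega
    exact Nat.mul_le_mul (Nat.mul_le_mul (hb 0) (hb 1)) (hb 2)
  obtain ⟨S, hS, hS'⟩ := hD.exists_int n hn0 hle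
  have hmap : ∀ x ∈ F, x.1 ∈ Fintype.piFinset fun _ : Fin 3 => S.image (· + τ) := by
    intro x hx
    rw [Fintype.mem_piFinset]
    intro i
    refine Finset.mem_image.2 ⟨x.1 i - τ, hS' _ ?_, by ring⟩
    rw [← hprod x hx]
    fin_cases i
    · exact ⟨_, mul_assoc _ _ _⟩
    · exact (dvd_mul_left _ _).mul_right _
    · exact dvd_mul_left _ _
  refine (Finset.card_le_mul_card_image_of_maps_to hmap 27
    (fun s _ => card_filter_fst_le F c (fun x hx => hA x (hFm x hx).1) s)).trans ?_
  rw [Fintype.card_piFinset_const]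
  exact Nat.mul_le_mul_left _ (Nat.pow_le_pow_left (Finset.card_image_le.trans hS) 3)

lemma card_filter_eval_eq_zero_le (A : Finset ((Fin 3 → ℤ) × (Fin 3 → ℤ))) (c : ℤ × ℤ × ℤ)
    (hc : c ≠ 0) (hA : ∀ x ∈ A, coeffDiff x = c)
    (h0 : ∀ x ∈ A, ∀ j, c.1 * x.2 j ^ 2 - c.2.1 * x.2 j + c.2.2 = 0) : A.card ≤ 216 := by
  classical
  obtain ⟨R, hR, hR'⟩ := exists_quadratic_roots c.1 c.2.1 c.2.2 hc
  have hmap : ∀ x ∈ A, x.2 ∈ Fintype.piFinset fun _ : Fin 3 => R :=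
    fun x hx => Fintype.mem_piFinset.2 fun i => hR' _ (h0 x hx i)
  refine (Finset.card_le_mul_card_image_of_maps_to hmap 27
    (fun s _ => card_filter_snd_le _ c hA s)).trans ?_
  rw [Fintype.card_piFinset_const]
  exact Nat.mul_le_mul_left 27 (Nat.pow_le_pow_left hR 3)

/-- A nonzero polynomial of degree at most `2` is a difference `∏ (X + s i) - ∏ (X + t i)` with
`s i, t i ∈ [1, H]` in at most `O(H D³)` ways. -/
lemma card_coeffDiff_eq_le {H D : ℕ} (hH : 1 ≤ H) (hD : DivisorBound (H ^ 3) D)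
    (c : ℤ × ℤ × ℤ) (hc : c ≠ 0) :
    ((tripleBox H ×ˢ tripleBox H).filter fun x => coeffDiff x = c).card ≤ 864 * (H * D ^ 3) := by
  classical
  set A := (tripleBox H ×ˢ tripleBox H).filter fun x => coeffDiff x = c with hAdef
  have hA : ∀ x ∈ A, coeffDiff x = c := fun x hx => (Finset.mem_filter.1 hx).2
  have hbox : ∀ x ∈ A, ∀ i, (1 ≤ x.1 i ∧ x.1 i ≤ H) ∧ (1 ≤ x.2 i ∧ x.2 i ≤ H) := by
    intro x hx i
    have := Finset.mem_product.1 (Finset.mem_filter.1 hx).1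
    exact ⟨mem_tripleBox.1 this.1 i, mem_tripleBox.1 this.2 i⟩
  have h1 (j : Fin 3) :
      (A.filter fun x => c.1 * x.2 j ^ 2 - c.2.1 * x.2 j + c.2.2 ≠ 0).card ≤
        27 * (2 * D) ^ 3 * H :=
    card_filter_eval_ne_zero_le hD _ c (fun x hx => hA x (Finset.mem_filter.1 hx).1)
      (fun x hx => hbox x (Finset.mem_filter.1 hx).1) j (fun x hx => (Finset.mem_filter.1 hx).2)
  have h2 : (A.filter fun x => ∀ j, c.1 * x.2 j ^ 2 - c.2.1 * x.2 j + c.2.2 = 0).card ≤ 216 :=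
    card_filter_eval_eq_zero_le _ c hc (fun x hx => hA x (Finset.mem_filter.1 hx).1)
      (fun x hx => (Finset.mem_filter.1 hx).2)
  have hcover : A ⊆ (Finset.univ.biUnion fun j =>
      A.filter fun x => c.1 * x.2 j ^ 2 - c.2.1 * x.2 j + c.2.2 ≠ 0) ∪
      A.filter fun x => ∀ j, c.1 * x.2 j ^ 2 - c.2.1 * x.2 j + c.2.2 = 0 := by
    intro x hx
    by_cases h : ∀ j, c.1 * x.2 j ^ 2 - c.2.1 * x.2 j + c.2.2 = 0
    · exact Finset.mem_union_right _ (Finset.mem_filter.2 ⟨hx, h⟩)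
    · push Not at h
      obtain ⟨j, hj⟩ := h
      exact Finset.mem_union_left _
        (Finset.mem_biUnion.2 ⟨j, Finset.mem_univ _, Finset.mem_filter.2 ⟨hx, hj⟩⟩)
  have h3 := Finset.card_biUnion_le_card_mul (Finset.univ : Finset (Fin 3)) _ _
    (fun j _ => h1 j)
  rw [Finset.card_univ, Fintype.card_fin] at h3
  have hD1 : 1 ≤ D := hD.one_le (Nat.one_le_pow _ _ hH)
  have h4 : 1 ≤ H * D ^ 3 := Nat.mul_pos hH (Nat.pow_pos hD1)
  have h5 := (Finset.card_le_card hcover).trans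
    ((Finset.card_union_le _ _).trans (add_le_add h3 h2))
  have h6 : 3 * (27 * (2 * D) ^ 3 * H) + 216 = 648 * (H * D ^ 3) + 216 := by ring
  rw [h6] at h5
  linarith

lemma card_coeffDiff_eq_zero_le (H : ℕ) :
    ((tripleBox H ×ˢ tripleBox H).filter fun x => coeffDiff x = 0).card ≤ 27 * H ^ 3 := by
  have hmap : ∀ x ∈ (tripleBox H ×ˢ tripleBox H).filter fun x => coeffDiff x = 0,
      x.1 ∈ tripleBox H := fun x hx => (Finset.mem_product.1 (Finset.mem_filter.1 hx).1).1
  have := Finset.card_le_mul_card_image_of_maps_to hmap 27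
    (fun s _ => card_filter_fst_le _ 0 (fun x hx => (Finset.mem_filter.1 hx).2) s)
  rwa [card_tripleBox] at this

/-! ### Quadratic polynomials with small coefficients and a given root modulo `p` -/

lemma card_le_mul_card_image_real {α β : Type*} [DecidableEq β] (A : Finset α) (f : α → β)
    (n : ℝ) (hn : ∀ b ∈ A.image f, ((A.filter fun x => f x = b).card : ℝ) ≤ n) :
    (A.card : ℝ) ≤ (A.image f).card * n := by
  rw [Finset.card_eq_sum_card_image f A]
  push_cast
  exact (Finset.sum_le_sum hn).trans (by simp)

/-- Integers that are congruent modulo `v` and lie within `W` of each other. -/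
lemma card_le_of_dvd_sub (A : Finset ℤ) (v : ℤ) (hv : 0 < v) (W : ℝ) (hW : 0 ≤ W)
    (h : ∀ x ∈ A, ∀ y ∈ A, v ∣ x - y ∧ |((x - y : ℤ) : ℝ)| ≤ W) :
    (A.card : ℝ) ≤ W / v + 1 := by
  have hv' : (0 : ℝ) < v := by exact_mod_cast hv
  rcases A.eq_empty_or_nonempty with rfl | hA
  · simp; positivity
  set m := A.min' hA with hm
  have hmA : m ∈ A := A.min'_mem hA
  have hcard : A.card ≤ (Finset.Icc (0 : ℤ) ⌊W / v⌋).card := by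
    refine Finset.card_le_card_of_injOn (fun x => (x - m) / v) (fun x hx => ?_) ?_
    · obtain ⟨⟨k, hk⟩, hW'⟩ := h x hx m hmA
      have hk' : (x - m) / v = k := by rw [hk, Int.mul_ediv_cancel_left _ hv.ne']
      have hnn : 0 ≤ x - m := sub_nonneg.2 (A.min'_le x hx)
      simp only [Finset.coe_Icc, Set.mem_Icc, hk']
      constructor
      · rw [hk] at hnn
        exact nonneg_of_mul_nonneg_right hnn hv
      · rw [Int.le_floor, le_div_iff₀ hv']
        refine le_trans (le_of_eq ?_) ((le_abs_self _).trans hW')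
        rw [hk]; push_cast; ring
    · intro x hx y hy hxy
      obtain ⟨⟨k, hk⟩, -⟩ := h x hx m hmA
      obtain ⟨⟨l, hl⟩, -⟩ := h y hy m hmA
      simp only at hxy
      rw [hk, hl, Int.mul_ediv_cancel_left _ hv.ne', Int.mul_ediv_cancel_left _ hv.ne'] at hxy
      rw [hxy] at hk
      linarith
  rw [Int.card_Icc] at hcard
  have h0 : (0 : ℤ) ≤ ⌊W / v⌋ := Int.floor_nonneg.2 (by positivity)
  have h1 : ((⌊W / v⌋ + 1 - 0).toNat : ℤ) = ⌊W / v⌋ + 1 := by omega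
  have h2 : (A.card : ℤ) ≤ ⌊W / v⌋ + 1 := by rw [← h1]; exact_mod_cast hcard
  calc (A.card : ℝ) ≤ (⌊W / v⌋ : ℝ) + 1 := by exact_mod_cast h2
    _ ≤ _ := by gcongr; exact Int.floor_le _

/-- Multiples of `p` other than `0`, of absolute value at most `W`. -/
lemma card_multiples_le (A : Finset ℤ) (p : ℤ) (hp : 0 < p) (W : ℝ) (hW : 0 ≤ W)
    (h : ∀ x ∈ A, p ∣ x ∧ x ≠ 0 ∧ |(x : ℝ)| ≤ W) : (A.card : ℝ) ≤ 2 * W / p := by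
  -- `0` is inserted so that the `+ 1` of the previous lemma is absorbed
  have h0 : (0 : ℤ) ∉ A := fun h0 => (h 0 h0).2.1 rfl
  have h1 : ∀ x ∈ insert 0 A, p ∣ x ∧ |(x : ℝ)| ≤ W := by
    intro x hx
    rcases Finset.mem_insert.1 hx with rfl | hx
    · simpa using hW
    · exact ⟨(h x hx).1, (h x hx).2.2⟩
  have := card_le_of_dvd_sub (insert 0 A) p hp (2 * W) (by positivity) (fun x hx y hy =>
    ⟨dvd_sub (h1 x hx).1 (h1 y hy).1, by
      push_cast
      have := abs_sub (x : ℝ) y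
      linarith [(h1 x hx).2, (h1 y hy).2]⟩)
  rw [Finset.card_insert_of_notMem h0] at this
  push_cast at this
  linarith

/-- The coefficient box containing all values of `coeffDiff` on `tripleBox H ×ˢ tripleBox H`. -/
def InCoeffBox (H : ℕ) (c : ℤ × ℤ × ℤ) : Prop :=
  |(c.1 : ℝ)| ≤ 3 * H ∧ |(c.2.1 : ℝ)| ≤ 3 * (H : ℝ) ^ 2 ∧ |(c.2.2 : ℝ)| ≤ (H : ℝ) ^ 3

/-- A fraction `u / v` in lowest terms, together with its height `U = max |u| (H v)` on the scale
of the interval length `H`. -/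
structure ScaledFraction (H : ℕ) (u v U : ℤ) : Prop where
  pos : 0 < v
  coprime : IsCoprime u v
  abs_le : |u| ≤ U
  mul_le : H * v ≤ U
  eq_or : U = H * v ∨ U = |u|

lemma ScaledFraction.pos_height {H : ℕ} {u v U : ℤ} (h : ScaledFraction H u v U) (hH : 1 ≤ H) :
    (0 : ℝ) < U := by
  have h1 := h.mul_le
  have h2 := h.pos
  have h3 : (1 : ℤ) ≤ H := by exact_mod_cast hH
  have : 0 < U := by nlinarith
  exact_mod_cast this

/-- The solutions of `β u + γ v = const` in a box of dimensions of order `H² × H³`. -/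
lemma card_linear_fiber_le {H : ℕ} {u v U : ℤ} (hH : 1 ≤ H) (h : ScaledFraction H u v U)
    (A : Finset (ℤ × ℤ × ℤ)) (hA : ∀ c ∈ A, InCoeffBox H c)
    (h1 : ∀ c ∈ A, ∀ d ∈ A, c.1 = d.1)
    (h2 : ∀ c ∈ A, ∀ d ∈ A, c.2.1 * u + c.2.2 * v = d.2.1 * u + d.2.2 * v) :
    (A.card : ℝ) ≤ 6 * (H : ℝ) ^ 3 / U + 1 := by
  have hU := h.pos_height hH
  have hHr : (1 : ℝ) ≤ H := by exact_mod_cast hH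
  have hv : (0 : ℝ) < v := by exact_mod_cast h.pos
  rcases h.eq_or with hE | hE
  · have hinj : Set.InjOn (fun c : ℤ × ℤ × ℤ => c.2.1) A := by
      intro c hc d hd hcd
      have h3 := h2 c hc d hd
      simp only at hcd
      rw [hcd] at h3
      exact Prod.ext (h1 c hc d hd)
        (Prod.ext hcd (mul_right_cancel₀ h.pos.ne' (add_left_cancel h3)))
    rw [← Finset.card_image_of_injOn hinj]
    refine (card_le_of_dvd_sub _ v h.pos (6 * (H : ℝ) ^ 2) (by positivity) ?_).trans
      (le_of_eq ?_)
    · intro x hx y hy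
      obtain ⟨c, hc, rfl⟩ := Finset.mem_image.1 hx
      obtain ⟨d, hd, rfl⟩ := Finset.mem_image.1 hy
      constructor
      · refine h.coprime.symm.dvd_of_dvd_mul_right (y := c.2.1 - d.2.1) ⟨d.2.2 - c.2.2, ?_⟩
        linear_combination h2 c hc d hd
      · push_cast
        have := abs_sub (c.2.1 : ℝ) d.2.1
        linarith [(hA c hc).2.1, (hA d hd).2.1]
    · rw [hE]
      push_cast
      field_simp
  · have hu : u ≠ 0 := by
      rintro rfl
      rw [hE] at hU
      simp at hU
    have hinj : Set.InjOn (fun c : ℤ × ℤ × ℤ => c.2.2) A := by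
      intro c hc d hd hcd
      have h3 := h2 c hc d hd
      simp only at hcd
      rw [hcd] at h3
      exact Prod.ext (h1 c hc d hd)
        (Prod.ext (mul_right_cancel₀ hu (add_right_cancel h3)) hcd)
    rw [← Finset.card_image_of_injOn hinj]
    refine (card_le_of_dvd_sub _ U (by exact_mod_cast hU) (2 * (H : ℝ) ^ 3)
      (by positivity) ?_).trans ?_
    · intro x hx y hy
      obtain ⟨c, hc, rfl⟩ := Finset.mem_image.1 hx
      obtain ⟨d, hd, rfl⟩ := Finset.mem_image.1 hy
      constructor
      · rw [hE, abs_dvd]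
        refine h.coprime.dvd_of_dvd_mul_right (y := c.2.2 - d.2.2) ⟨d.2.1 - c.2.1, ?_⟩
        linear_combination h2 c hc d hd
      · push_cast
        have := abs_sub (c.2.2 : ℝ) d.2.2
        linarith [(hA c hc).2.2, (hA d hd).2.2]
    · gcongr
      norm_num

/-- Polynomials `α X² + β X + γ` in the coefficient box with a root `L` modulo `p`, when `L` is
congruent to a fraction of height at least `H²`: the leading coefficient is fixed first. -/
lemma card_small_polys_le_of_large {p H : ℕ} {L u v U : ℤ} (hp : 0 < p) (hH : 1 ≤ H)
    (hHp : H ^ 4 ≤ p) (h : ScaledFraction H u v U) (hL : (p : ℤ) ∣ v * L - u)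
    (hU₁ : (H : ℝ) ^ 2 ≤ U) (hU₂ : (U : ℝ) ≤ (H : ℝ) ^ 3)
    (A : Finset (ℤ × ℤ × ℤ)) (hA : ∀ c ∈ A, InCoeffBox H c)
    (hAL : ∀ c ∈ A, (p : ℤ) ∣ c.1 * L ^ 2 + c.2.1 * L + c.2.2) :
    (A.card : ℝ) ≤ 441 * (H : ℝ) ^ 2 := by
  have hU := h.pos_height hH
  have hHr : (1 : ℝ) ≤ H := by exact_mod_cast hH
  have hpr : (0 : ℝ) < p := by exact_mod_cast hp
  have hHp' : (H : ℝ) ^ 4 ≤ p := by exact_mod_cast hHp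
  have hu : |(u : ℝ)| ≤ U := by exact_mod_cast h.abs_le
  have hv : (0 : ℝ) < v := by exact_mod_cast h.pos
  have hvU : (H : ℝ) * v ≤ U := by exact_mod_cast h.mul_le
  -- the number of leading coefficients
  have hlead : ((A.image fun c => c.1).card : ℝ) ≤ 7 * H := by
    have := card_le_of_dvd_sub (A.image fun c => c.1) 1 one_pos (6 * H) (by positivity) ?_
    · refine this.trans ?_
      push_cast
      rw [div_one]
      linarith
    intro x hx y hy
    obtain ⟨c, hc, rfl⟩ := Finset.mem_image.1 hx
    obtain ⟨d, hd, rfl⟩ := Finset.mem_image.1 hy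
    refine ⟨one_dvd _, ?_⟩
    push_cast
    have := abs_sub (c.1 : ℝ) d.1
    linarith [(hA c hc).1, (hA d hd).1]
  have hfib : ∀ a ∈ A.image fun c => c.1,
      ((A.filter fun c => c.1 = a).card : ℝ) ≤ 63 * H := by
    intro a _
    set B := A.filter fun c => c.1 = a with hB
    have hBA : ∀ c ∈ B, c ∈ A ∧ c.1 = a := fun c hc => Finset.mem_filter.1 hc
    -- the values of `β u + γ v` lie in one class modulo `p`
    have hval : ((B.image fun c => c.2.1 * u + c.2.2 * v).card : ℝ) ≤ 9 * U / (H : ℝ) ^ 2 := by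
      have := card_le_of_dvd_sub (B.image fun c => c.2.1 * u + c.2.2 * v) p
        (by exact_mod_cast hp) (8 * (H : ℝ) ^ 2 * U) (by positivity) ?_
      · refine this.trans ?_
        push_cast
        have h1 : 8 * (H : ℝ) ^ 2 * U / p ≤ 8 * U / (H : ℝ) ^ 2 := by
          rw [div_le_div_iff₀ hpr (by positivity)]
          calc 8 * (H : ℝ) ^ 2 * U * (H : ℝ) ^ 2 = 8 * (U : ℝ) * (H : ℝ) ^ 4 := by ring
            _ ≤ 8 * (U : ℝ) * p := by gcongr
        have h2 : 1 ≤ (U : ℝ) / (H : ℝ) ^ 2 := by rwa [one_le_div (by positivity)]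
        calc _ ≤ 8 * (U : ℝ) / (H : ℝ) ^ 2 + U / (H : ℝ) ^ 2 := add_le_add h1 h2
          _ = _ := by ring
      intro x hx y hy
      obtain ⟨c, hc, rfl⟩ := Finset.mem_image.1 hx
      obtain ⟨d, hd, rfl⟩ := Finset.mem_image.1 hy
      obtain ⟨hc, hca⟩ := hBA c hc
      obtain ⟨hd, hda⟩ := hBA d hd
      constructor
      · have h1 := dvd_sub (hAL c hc) (hAL d hd)
        rw [hca, hda] at h1
        have h2 := dvd_sub (h1.mul_left v) (hL.mul_left (c.2.1 - d.2.1))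
        have e : c.2.1 * u + c.2.2 * v - (d.2.1 * u + d.2.2 * v) =
            v * (a * L ^ 2 + c.2.1 * L + c.2.2 - (a * L ^ 2 + d.2.1 * L + d.2.2)) -
              (c.2.1 - d.2.1) * (v * L - u) := by ring
        rw [e]
        exact h2
      · have e : ((c.2.1 * u + c.2.2 * v - (d.2.1 * u + d.2.2 * v) : ℤ) : ℝ) =
            ((c.2.1 : ℝ) - d.2.1) * u + ((c.2.2 : ℝ) - d.2.2) * v := by push_cast; ring
        rw [e]
        have h1 : |(c.2.1 : ℝ) - d.2.1| ≤ 6 * (H : ℝ) ^ 2 := by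
          have := abs_sub (c.2.1 : ℝ) d.2.1
          linarith [(hA c hc).2.1, (hA d hd).2.1]
        have h2 : |(c.2.2 : ℝ) - d.2.2| ≤ 2 * (H : ℝ) ^ 3 := by
          have := abs_sub (c.2.2 : ℝ) d.2.2
          linarith [(hA c hc).2.2, (hA d hd).2.2]
        calc _ ≤ |(c.2.1 : ℝ) - d.2.1| * |(u : ℝ)| + |(c.2.2 : ℝ) - d.2.2| * v := by
              refine (abs_add_le _ _).trans ?_
              rw [abs_mul, abs_mul, abs_of_pos hv]
          _ ≤ 6 * (H : ℝ) ^ 2 * U + 2 * (H : ℝ) ^ 3 * v := by gcongr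
          _ = 6 * (H : ℝ) ^ 2 * U + 2 * (H : ℝ) ^ 2 * (H * v) := by ring
          _ ≤ 6 * (H : ℝ) ^ 2 * U + 2 * (H : ℝ) ^ 2 * U := by gcongr
          _ = _ := by ring
    have hfib' : ∀ b ∈ B.image fun c => c.2.1 * u + c.2.2 * v,
        ((B.filter fun c => c.2.1 * u + c.2.2 * v = b).card : ℝ) ≤ 7 * (H : ℝ) ^ 3 / U := by
      intro b _
      refine (card_linear_fiber_le hH h _
        (fun c hc => hA c (hBA c (Finset.mem_filter.1 hc).1).1) (fun c hc d hd => ?_)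
        (fun c hc d hd => ?_)).trans ?_
      · rw [(hBA c (Finset.mem_filter.1 hc).1).2, (hBA d (Finset.mem_filter.1 hd).1).2]
      · rw [(Finset.mem_filter.1 hc).2, (Finset.mem_filter.1 hd).2]
      · have h2 : 1 ≤ (H : ℝ) ^ 3 / U := by rwa [one_le_div hU]
        calc _ ≤ 6 * (H : ℝ) ^ 3 / U + (H : ℝ) ^ 3 / U := by gcongr
          _ = _ := by ring
    refine (card_le_mul_card_image_real B _ _ hfib').trans ?_
    calc _ ≤ (9 * U / (H : ℝ) ^ 2) * (7 * (H : ℝ) ^ 3 / U) := by gcongr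
      _ = 63 * H := by field_simp; ring
  refine (card_le_mul_card_image_real A _ _ hfib).trans ?_
  calc _ ≤ (7 * H : ℝ) * (63 * H) := by gcongr
    _ = _ := by ring

/-- Polynomials `α X² + β X + γ` in the coefficient box with a root `L` modulo `p`, when `L` is
congruent to a fraction `u / v` of height at most `H²` that is not itself a root:
`α u² + β u v + γ v²` is a nonzero multiple of `p`, and its value is fixed first. -/
lemma card_small_polys_le_of_small {p H : ℕ} {L u v U : ℤ} (hp : 0 < p) (hH : 1 ≤ H)
    (hHp : H ^ 4 ≤ p) (h : ScaledFraction H u v U) (hL : (p : ℤ) ∣ v * L - u)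
    (hU₁ : (U : ℝ) ≤ (H : ℝ) ^ 2)
    (A : Finset (ℤ × ℤ × ℤ)) (hA : ∀ c ∈ A, InCoeffBox H c)
    (hAL : ∀ c ∈ A, (p : ℤ) ∣ c.1 * L ^ 2 + c.2.1 * L + c.2.2)
    (hne : ∀ c ∈ A, c.1 * u ^ 2 + c.2.1 * u * v + c.2.2 * v ^ 2 ≠ 0) :
    (A.card : ℝ) ≤ 882 * (H : ℝ) ^ 2 := by
  have hU := h.pos_height hH
  have hHr : (1 : ℝ) ≤ H := by exact_mod_cast hH
  have hpr : (0 : ℝ) < p := by exact_mod_cast hp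
  have hHp' : (H : ℝ) ^ 4 ≤ p := by exact_mod_cast hHp
  have hu : |(u : ℝ)| ≤ U := by exact_mod_cast h.abs_le
  have hv : (0 : ℝ) < v := by exact_mod_cast h.pos
  have hvU : (H : ℝ) * v ≤ U := by exact_mod_cast h.mul_le
  have hU2 : 1 ≤ (H : ℝ) ^ 2 / U := by rwa [one_le_div hU]
  have hU3 : 1 ≤ (H : ℝ) ^ 3 / U := by
    rw [one_le_div hU]
    exact hU₁.trans (pow_le_pow_right₀ hHr (by norm_num))
  set M : ℤ × ℤ × ℤ → ℤ := fun c => c.1 * u ^ 2 + c.2.1 * u * v + c.2.2 * v ^ 2 with hM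
  have hval : ((A.image M).card : ℝ) ≤ 14 * H * (U : ℝ) ^ 2 / p := by
    have := card_multiples_le (A.image M) p (by exact_mod_cast hp) (7 * H * (U : ℝ) ^ 2)
      (by positivity) ?_
    · refine this.trans (le_of_eq ?_)
      push_cast
      ring
    intro x hx
    obtain ⟨c, hc, rfl⟩ := Finset.mem_image.1 hx
    refine ⟨?_, hne c hc, ?_⟩
    · have h1 := dvd_sub ((hAL c hc).mul_left (v ^ 2))
        (hL.mul_left (c.1 * (v * L + u) + c.2.1 * v))
      have e : M c = v ^ 2 * (c.1 * L ^ 2 + c.2.1 * L + c.2.2) -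
          (c.1 * (v * L + u) + c.2.1 * v) * (v * L - u) := by
        simp only [hM]
        ring
      rw [e]
      exact h1
    · simp only [hM]
      push_cast
      obtain ⟨h1, h2, h3⟩ := hA c hc
      calc _ ≤ |(c.1 : ℝ)| * |(u : ℝ)| ^ 2 + |(c.2.1 : ℝ)| * |(u : ℝ)| * v +
            |(c.2.2 : ℝ)| * v ^ 2 := by
            refine (abs_add_le _ _).trans (add_le_add ((abs_add_le _ _).trans ?_) ?_)
            · rw [abs_mul, abs_mul, abs_mul, abs_pow, abs_of_pos hv]
            · rw [abs_mul, abs_pow, abs_of_pos hv]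
        _ ≤ 3 * H * (U : ℝ) ^ 2 + 3 * (H : ℝ) ^ 2 * U * v + (H : ℝ) ^ 3 * v ^ 2 := by gcongr
        _ = 3 * H * (U : ℝ) ^ 2 + 3 * H * U * (H * v) + H * (H * v) ^ 2 := by ring
        _ ≤ 3 * H * (U : ℝ) ^ 2 + 3 * H * U * U + H * (U : ℝ) ^ 2 := by gcongr
        _ = _ := by ring
  have hfib : ∀ m ∈ A.image M, ((A.filter fun c => M c = m).card : ℝ) ≤
      (9 * (H : ℝ) ^ 2 / U) * (7 * (H : ℝ) ^ 3 / U) := by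
    intro m _
    set B := A.filter fun c => M c = m with hB
    have hBA : ∀ c ∈ B, c ∈ A ∧ M c = m := fun c hc => Finset.mem_filter.1 hc
    have hlead : ((B.image fun c => c.1).card : ℝ) ≤ 9 * (H : ℝ) ^ 2 / U := by
      have hdvd : ∀ c ∈ B, ∀ d ∈ B, v ∣ c.1 - d.1 := by
        intro c hc d hd
        have h1 : M c = M d := (hBA c hc).2.trans (hBA d hd).2.symm
        simp only [hM] at h1
        refine (h.coprime.symm.pow_right (n := 2)).dvd_of_dvd_mul_right (y := c.1 - d.1)
          ⟨(d.2.1 - c.2.1) * u + (d.2.2 - c.2.2) * v, ?_⟩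
        linear_combination h1
      have hW : ∀ c ∈ B, ∀ d ∈ B, |((c.1 - d.1 : ℤ) : ℝ)| ≤ 8 * (H : ℝ) ^ 2 * v / U := by
        intro c hc d hd
        have h1 : M c = M d := (hBA c hc).2.trans (hBA d hd).2.symm
        simp only [hM] at h1
        have hc' := hA c (hBA c hc).1
        have hd' := hA d (hBA d hd).1
        push_cast
        rcases h.eq_or with hE | hE
        · have e : 8 * (H : ℝ) ^ 2 * v / U = 8 * H := by
            rw [hE]; push_cast; field_simp
          rw [e]
          have := abs_sub (c.1 : ℝ) d.1
          linarith [hc'.1, hd'.1]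
        · have hur : |(u : ℝ)| = U := by rw [hE]; push_cast; rfl
          have h2 : |(c.2.1 : ℝ) - d.2.1| ≤ 6 * (H : ℝ) ^ 2 := by
            have := abs_sub (c.2.1 : ℝ) d.2.1
            linarith [hc'.2.1, hd'.2.1]
          have h3 : |(c.2.2 : ℝ) - d.2.2| ≤ 2 * (H : ℝ) ^ 3 := by
            have := abs_sub (c.2.2 : ℝ) d.2.2
            linarith [hc'.2.2, hd'.2.2]
          have h1' : ((c.1 : ℝ) - d.1) * u ^ 2 =
              -(((c.2.1 : ℝ) - d.2.1) * u * v + ((c.2.2 : ℝ) - d.2.2) * v ^ 2) := by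
            have : ((c.1 * u ^ 2 + c.2.1 * u * v + c.2.2 * v ^ 2 : ℤ) : ℝ) =
              ((d.1 * u ^ 2 + d.2.1 * u * v + d.2.2 * v ^ 2 : ℤ) : ℝ) := by rw [h1]
            push_cast at this
            linear_combination this
          have h4 : |(c.1 : ℝ) - d.1| * (U : ℝ) ^ 2 ≤ 8 * (H : ℝ) ^ 2 * v * U := by
            calc |(c.1 : ℝ) - d.1| * (U : ℝ) ^ 2 = |((c.1 : ℝ) - d.1) * u ^ 2| := by
                  rw [abs_mul, abs_pow, hur]
              _ ≤ |(c.2.1 : ℝ) - d.2.1| * U * v + |(c.2.2 : ℝ) - d.2.2| * v ^ 2 := by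
                  rw [h1', abs_neg]
                  refine (abs_add_le _ _).trans ?_
                  rw [abs_mul, abs_mul, abs_mul, abs_pow, hur, abs_of_pos hv]
              _ ≤ 6 * (H : ℝ) ^ 2 * U * v + 2 * (H : ℝ) ^ 3 * v ^ 2 := by gcongr
              _ = 6 * (H : ℝ) ^ 2 * U * v + 2 * (H : ℝ) ^ 2 * (H * v) * v := by ring
              _ ≤ 6 * (H : ℝ) ^ 2 * U * v + 2 * (H : ℝ) ^ 2 * U * v := by gcongr
              _ = _ := by ring
          rw [le_div_iff₀ hU]
          refine le_of_mul_le_mul_right ?_ hU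
          calc _ = |(c.1 : ℝ) - d.1| * (U : ℝ) ^ 2 := by ring
            _ ≤ _ := h4
      have := card_le_of_dvd_sub (B.image fun c => c.1) v h.pos (8 * (H : ℝ) ^ 2 * v / U)
        (by positivity) ?_
      · refine this.trans ?_
        have e : 8 * (H : ℝ) ^ 2 * v / U / v = 8 * (H : ℝ) ^ 2 / U := by field_simp
        rw [e]
        calc _ ≤ 8 * (H : ℝ) ^ 2 / U + (H : ℝ) ^ 2 / U := by gcongr
          _ = _ := by ring
      intro x hx y hy
      obtain ⟨c, hc, rfl⟩ := Finset.mem_image.1 hx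
      obtain ⟨d, hd, rfl⟩ := Finset.mem_image.1 hy
      exact ⟨hdvd c hc d hd, hW c hc d hd⟩
    have hfib' : ∀ a ∈ B.image fun c => c.1,
        ((B.filter fun c => c.1 = a).card : ℝ) ≤ 7 * (H : ℝ) ^ 3 / U := by
      intro a _
      refine (card_linear_fiber_le hH h _
        (fun c hc => hA c (hBA c (Finset.mem_filter.1 hc).1).1) (fun c hc d hd => ?_)
        (fun c hc d hd => ?_)).trans ?_
      · rw [(Finset.mem_filter.1 hc).2, (Finset.mem_filter.1 hd).2]
      · obtain ⟨hc, hca⟩ := Finset.mem_filter.1 hc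
        obtain ⟨hd, hda⟩ := Finset.mem_filter.1 hd
        have h1 : M c = M d := (hBA c hc).2.trans (hBA d hd).2.symm
        simp only [hM, hca, hda] at h1
        refine mul_right_cancel₀ h.pos.ne' ?_
        linear_combination h1
      · calc _ ≤ 6 * (H : ℝ) ^ 3 / U + (H : ℝ) ^ 3 / U := by gcongr
          _ = _ := by ring
    refine (card_le_mul_card_image_real B _ _ hfib').trans ?_
    gcongr
  refine (card_le_mul_card_image_real A _ _ hfib).trans ?_
  calc _ ≤ (14 * H * (U : ℝ) ^ 2 / p) * ((9 * (H : ℝ) ^ 2 / U) * (7 * (H : ℝ) ^ 3 / U)) := by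
        gcongr
    _ = 882 * (H : ℝ) ^ 2 * ((H : ℝ) ^ 4 / p) := by field_simp; ring
    _ ≤ 882 * (H : ℝ) ^ 2 * 1 := by gcongr; rwa [div_le_one hpr]
    _ = _ := by ring

/-- Dirichlet's theorem: every residue class is that of a fraction of height at most `H³`. -/
lemma exists_scaledFraction {p H : ℕ} (hp : p.Prime) (hH : 1 ≤ H) (hHp : H ^ 4 ≤ p)
    (hpH : p ≤ H ^ 5) (L : ℤ) :
    ∃ u v U : ℤ, ScaledFraction H u v U ∧ (p : ℤ) ∣ v * L - u ∧ U ≤ H ^ 3 ∧ ¬ (p : ℤ) ∣ v := by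
  have hH2 : 0 < H ^ 2 := Nat.pow_pos hH
  have hlt : H ^ 2 < p := by
    have h1 : H ^ 4 = H ^ 2 * H ^ 2 := by ring
    have h2 := hp.two_le
    nlinarith
  have hpr : (0 : ℝ) < p := by exact_mod_cast hp.pos
  obtain ⟨q, hq, hden⟩ := Real.exists_rat_abs_sub_le_and_den_le ((L : ℝ) / p) hH2
  have hd : (0 : ℝ) < q.den := by exact_mod_cast q.den_pos
  have hpv : ¬ (p : ℤ) ∣ (q.den : ℤ) := by
    intro hdvd
    have := Nat.le_of_dvd q.den_pos (Int.natCast_dvd_natCast.1 hdvd)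
    omega
  have hu : |((q.den : ℤ) * L - q.num * p)| ≤ (H : ℤ) ^ 3 := by
    have h1 : (((q.den : ℤ) * L - q.num * p : ℤ) : ℝ) = ((L : ℝ) / p - q) * (q.den * p) := by
      have : (q : ℝ) = q.num / q.den := by exact_mod_cast (Rat.num_div_den q).symm
      rw [this]
      push_cast
      field_simp
    have h2 : |(((q.den : ℤ) * L - q.num * p : ℤ) : ℝ)| ≤ (H : ℝ) ^ 3 := by
      rw [h1, abs_mul, abs_of_pos (mul_pos hd hpr)]
      have hH5 : (p : ℝ) ≤ (H : ℝ) ^ 5 := by exact_mod_cast hpH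
      have hHr : (1 : ℝ) ≤ H := by exact_mod_cast hH
      push_cast at hq
      calc _ ≤ 1 / (((H : ℝ) ^ 2 + 1) * q.den) * (q.den * p) := by gcongr
        _ = p / ((H : ℝ) ^ 2 + 1) := by field_simp
        _ ≤ (H : ℝ) ^ 5 / ((H : ℝ) ^ 2) := by gcongr; linarith
        _ = (H : ℝ) ^ 3 := by field_simp
    exact_mod_cast h2
  refine ⟨q.den * L - q.num * p, q.den, max |((q.den : ℤ) * L - q.num * p)| (H * q.den),
    ⟨by exact_mod_cast q.den_pos, ?_, le_max_left _ _, le_max_right _ _, ?_⟩, ?_, ?_, hpv⟩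
  · have h1 : IsCoprime q.num (q.den : ℤ) := by
      rw [Int.isCoprime_iff_gcd_eq_one]
      exact q.reduced
    have h2 : IsCoprime (p : ℤ) (q.den : ℤ) :=
      (Nat.prime_iff_prime_int.1 hp).irreducible.coprime_iff_not_dvd.2 hpv
    have h3 : IsCoprime (-(q.num * p)) (q.den : ℤ) := (h1.mul_left h2).neg_left
    have e : (q.den : ℤ) * L - q.num * p = -(q.num * p) + q.den * L := by ring
    rw [e]
    exact h3.add_mul_left_left L
  · rcases max_choice |((q.den : ℤ) * L - q.num * p)| (H * q.den) with h | h
    · exact Or.inr h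
    · exact Or.inl h
  · exact ⟨q.num, by ring⟩
  · refine max_le hu ?_
    have : (q.den : ℤ) ≤ H ^ 2 := by exact_mod_cast hden
    calc (H : ℤ) * q.den ≤ H * H ^ 2 := by gcongr
      _ = _ := by ring

/-! ### Products of three elements of a short interval -/

/-- The pairs of triples in `[1, H]` with `∏ (L + s i) ≡ ∏ (L + t i)` modulo `p`. -/
noncomputable def tripleSolutions (p H : ℕ) (L : ℤ) : Finset ((Fin 3 → ℤ) × (Fin 3 → ℤ)) :=
  (tripleBox H ×ˢ tripleBox H).filter fun x =>
    (p : ℤ) ∣ (L + x.1 0) * (L + x.1 1) * (L + x.1 2) - (L + x.2 0) * (L + x.2 1) * (L + x.2 2)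

/-- Equality of two nonzero products of integers in a short progression has few solutions, by the
divisor bound. -/
lemma card_integer_solutions_le {H D : ℕ} (hD : DivisorBound (8 * H ^ 6) D) (u v : ℤ)
    (hv : v ≠ 0) (hne : ∀ s : ℤ, 1 ≤ s → s ≤ H → u + v * s ≠ 0)
    (hle : ∀ s : ℤ, 1 ≤ s → s ≤ H → (u + v * s).natAbs ≤ 2 * H ^ 2)
    (A : Finset ((Fin 3 → ℤ) × (Fin 3 → ℤ))) (hA : A ⊆ tripleBox H ×ˢ tripleBox H)
    (hprod : ∀ x ∈ A, (u + v * x.1 0) * (u + v * x.1 1) * (u + v * x.1 2) =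
      (u + v * x.2 0) * (u + v * x.2 1) * (u + v * x.2 2)) :
    A.card ≤ (2 * D) ^ 3 * H ^ 3 := by
  classical
  have hmap : ∀ x ∈ A, x.2 ∈ tripleBox H := fun x hx => (Finset.mem_product.1 (hA hx)).2
  have := Finset.card_le_mul_card_image_of_maps_to hmap ((2 * D) ^ 3) ?_
  · rwa [card_tripleBox] at this
  intro t ht
  rw [mem_tripleBox] at ht
  set F := A.filter fun x => x.2 = t with hF
  set n : ℤ := (u + v * t 0) * (u + v * t 1) * (u + v * t 2) with hn
  have hn0 : n ≠ 0 := mul_ne_zero (mul_ne_zero (hne _ (ht 0).1 (ht 0).2) (hne _ (ht 1).1 (ht 1).2))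
    (hne _ (ht 2).1 (ht 2).2)
  have hnle : n.natAbs ≤ 8 * H ^ 6 := by
    rw [hn, Int.natAbs_mul, Int.natAbs_mul]
    calc _ ≤ (2 * H ^ 2) * (2 * H ^ 2) * (2 * H ^ 2) :=
          Nat.mul_le_mul (Nat.mul_le_mul (hle _ (ht 0).1 (ht 0).2) (hle _ (ht 1).1 (ht 1).2))
            (hle _ (ht 2).1 (ht 2).2)
      _ = _ := by ring
  obtain ⟨S, hS, hS'⟩ := hD.exists_int n hn0 hnle
  have hcard : F.card ≤ (Fintype.piFinset fun _ : Fin 3 => S).card := by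
    refine Finset.card_le_card_of_injOn (fun x i => u + v * x.1 i) (fun x hx => ?_) ?_
    · obtain ⟨hxA, rfl⟩ := Finset.mem_filter.1 hx
      rw [Finset.mem_coe, Fintype.mem_piFinset]
      intro i
      refine hS' _ ?_
      rw [hn, ← hprod x hxA]
      fin_cases i
      · exact ⟨_, mul_assoc _ _ _⟩
      · exact (dvd_mul_left _ _).mul_right _
      · exact dvd_mul_left _ _
    · intro x hx y hy hxy
      have hx2 := (Finset.mem_filter.1 (Finset.mem_coe.1 hx)).2
      have hy2 := (Finset.mem_filter.1 (Finset.mem_coe.1 hy)).2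
      refine Prod.ext (funext fun i => ?_) (hx2.trans hy2.symm)
      exact mul_left_cancel₀ hv (add_left_cancel (congrFun hxy i))
  rw [Fintype.card_piFinset_const] at hcard
  exact hcard.trans (Nat.pow_le_pow_left hS 3)

lemma inCoeffBox_coeffDiff {H : ℕ} {x : (Fin 3 → ℤ) × (Fin 3 → ℤ)}
    (hx : x ∈ tripleBox H ×ˢ tripleBox H) : InCoeffBox H (coeffDiff x) := by
  obtain ⟨hs, ht⟩ := Finset.mem_product.1 hx
  rw [mem_tripleBox] at hs ht
  -- all three symmetric functions are nonnegative, so it suffices to bound each of them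
  have key : ∀ s : Fin 3 → ℤ, (∀ i, 1 ≤ s i ∧ s i ≤ H) →
      (0 ≤ esymm₁ s ∧ esymm₁ s ≤ 3 * H) ∧ (0 ≤ esymm₂ s ∧ esymm₂ s ≤ 3 * (H : ℤ) ^ 2) ∧
      (0 ≤ esymm₃ s ∧ esymm₃ s ≤ (H : ℤ) ^ 3) := by
    intro s hs
    obtain ⟨a1, a2⟩ := hs 0
    obtain ⟨b1, b2⟩ := hs 1
    obtain ⟨c1, c2⟩ := hs 2
    have hH : (0 : ℤ) ≤ H := by positivity
    have h1 : s 0 * s 1 ≤ H * H := mul_le_mul a2 b2 (by linarith) hH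
    have h2 : s 0 * s 2 ≤ H * H := mul_le_mul a2 c2 (by linarith) hH
    have h3 : s 1 * s 2 ≤ H * H := mul_le_mul b2 c2 (by linarith) hH
    have h4 : s 0 * s 1 * s 2 ≤ H * H * H := mul_le_mul h1 c2 (by linarith) (by positivity)
    have p0 : 0 ≤ s 0 := by linarith
    have p1 : 0 ≤ s 1 := by linarith
    have p2 : 0 ≤ s 2 := by linarith
    refine ⟨⟨by unfold esymm₁; positivity, by unfold esymm₁; linarith⟩,
      ⟨by unfold esymm₂; positivity, by unfold esymm₂; linarith⟩,
      ⟨by unfold esymm₃; positivity, by unfold esymm₃; linarith⟩⟩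
  obtain ⟨⟨a1, a2⟩, ⟨a3, a4⟩, a5, a6⟩ := key _ hs
  obtain ⟨⟨b1, b2⟩, ⟨b3, b4⟩, b5, b6⟩ := key _ ht
  have h1 : |(coeffDiff x).1| ≤ 3 * H := by
    simp only [coeffDiff]; rw [abs_le]; constructor <;> linarith
  have h2 : |(coeffDiff x).2.1| ≤ 3 * (H : ℤ) ^ 2 := by
    simp only [coeffDiff]; rw [abs_le]; constructor <;> linarith
  have h3 : |(coeffDiff x).2.2| ≤ (H : ℤ) ^ 3 := by
    simp only [coeffDiff]; rw [abs_le]; constructor <;> linarith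
  exact ⟨by exact_mod_cast h1, by exact_mod_cast h2, by exact_mod_cast h3⟩

lemma dvd_coeffDiff {p H : ℕ} {L : ℤ} {x : (Fin 3 → ℤ) × (Fin 3 → ℤ)}
    (hx : x ∈ tripleSolutions p H L) :
    (p : ℤ) ∣ (coeffDiff x).1 * L ^ 2 + (coeffDiff x).2.1 * L + (coeffDiff x).2.2 := by
  have h := (Finset.mem_filter.1 hx).2
  have e : (coeffDiff x).1 * L ^ 2 + (coeffDiff x).2.1 * L + (coeffDiff x).2.2 =
      (L + x.1 0) * (L + x.1 1) * (L + x.1 2) - (L + x.2 0) * (L + x.2 1) * (L + x.2 2) := by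
    simp only [coeffDiff, esymm₁, esymm₂, esymm₃]
    ring
  rwa [e]

/-- If the possible values of `coeffDiff` on a set of pairs of triples are few and nonzero, then
the set is small. -/
lemma card_le_of_card_image_coeffDiff_le {H D : ℕ} (hH : 1 ≤ H) (hD : DivisorBound (H ^ 3) D)
    (A : Finset ((Fin 3 → ℤ) × (Fin 3 → ℤ))) (hA : A ⊆ tripleBox H ×ˢ tripleBox H)
    (hne : ∀ x ∈ A, coeffDiff x ≠ 0) (K : ℝ) (hK : ((A.image coeffDiff).card : ℝ) ≤ K) :
    (A.card : ℝ) ≤ K * (864 * (H * (D : ℝ) ^ 3)) := by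
  classical
  refine (card_le_mul_card_image_real A coeffDiff (864 * (H * (D : ℝ) ^ 3)) ?_).trans
    (by gcongr)
  intro c hc
  obtain ⟨x, hx, rfl⟩ := Finset.mem_image.1 hc
  have h1 := card_coeffDiff_eq_le hH hD (coeffDiff x) (hne x hx)
  have h2 : (A.filter fun y => coeffDiff y = coeffDiff x).card ≤ 864 * (H * D ^ 3) :=
    (Finset.card_le_card (Finset.filter_subset_filter _ hA)).trans h1
  exact_mod_cast h2

/-- The congruence `∏ (L + s i) ≡ ∏ (L + t i)` modulo `p` with `s i, t i ∈ [1, H]` and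
`H ≤ p ^ (1 / 4)` has essentially only `O(H³)` solutions. -/
theorem card_tripleSolutions_le {p H D : ℕ} (hp : p.Prime) (hH : 1 ≤ H) (hHp : H ^ 4 ≤ p)
    (hpH : p ≤ H ^ 5) (hD : DivisorBound (8 * H ^ 6) D) (L : ℤ)
    (hL : ∀ s : ℤ, 1 ≤ s → s ≤ H → ¬ (p : ℤ) ∣ L + s) :
    ((tripleSolutions p H L).card : ℝ) ≤ 10 ^ 6 * ((D : ℝ) ^ 3 * (H : ℝ) ^ 3) := by
  classical
  obtain ⟨u, v, U, hF, hdvd, hU, hpv⟩ := exists_scaledFraction hp hH hHp hpH L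
  have hHr : (1 : ℝ) ≤ H := by exact_mod_cast hH
  have hle36 : H ^ 3 ≤ 8 * H ^ 6 := by
    calc H ^ 3 ≤ H ^ 6 := Nat.pow_le_pow_right hH (by norm_num)
      _ ≤ _ := by omega
  have hD3 : DivisorBound (H ^ 3) D := hD.mono hle36
  have hD1 : (1 : ℝ) ≤ D := by
    exact_mod_cast hD3.one_le (Nat.one_le_pow _ _ hH)
  have hDH : (H : ℝ) ^ 3 ≤ (D : ℝ) ^ 3 * (H : ℝ) ^ 3 :=
    le_mul_of_one_le_left (by positivity) (one_le_pow₀ hD1)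
  have hpos : 0 ≤ (D : ℝ) ^ 3 * (H : ℝ) ^ 3 := by positivity
  set T := tripleSolutions p H L with hT
  have hTbox : T ⊆ tripleBox H ×ˢ tripleBox H := Finset.filter_subset _ _
  rcases le_total ((H : ℝ) ^ 2) U with hUH | hUH
  · have hzero : ((T.filter fun x => coeffDiff x = 0).card : ℝ) ≤ 27 * (H : ℝ) ^ 3 := by
      exact_mod_cast (Finset.card_le_card (Finset.filter_subset_filter _ hTbox)).trans
        (card_coeffDiff_eq_zero_le H)
    have himg : (((T.filter fun x => ¬ coeffDiff x = 0).image coeffDiff).card : ℝ) ≤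
        441 * (H : ℝ) ^ 2 := by
      refine card_small_polys_le_of_large hp.pos hH hHp hF hdvd hUH (by exact_mod_cast hU) _ ?_ ?_
      · intro c hc
        obtain ⟨x, hx, rfl⟩ := Finset.mem_image.1 hc
        exact inCoeffBox_coeffDiff (hTbox (Finset.mem_filter.1 hx).1)
      · intro c hc
        obtain ⟨x, hx, rfl⟩ := Finset.mem_image.1 hc
        exact dvd_coeffDiff (Finset.mem_filter.1 hx).1
    have hnz := card_le_of_card_image_coeffDiff_le hH hD3 (T.filter fun x => ¬ coeffDiff x = 0)
      ((Finset.filter_subset _ _).trans hTbox) (fun x hx => (Finset.mem_filter.1 hx).2) _ himg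
    have hsum : (T.card : ℝ) = ((T.filter fun x => coeffDiff x = 0).card : ℝ) +
        ((T.filter fun x => ¬ coeffDiff x = 0).card : ℝ) := by
      exact_mod_cast (Finset.card_filter_add_card_filter_not _).symm
    have e : 441 * (H : ℝ) ^ 2 * (864 * (H * (D : ℝ) ^ 3)) =
        381024 * ((D : ℝ) ^ 3 * (H : ℝ) ^ 3) := by ring
    linarith
  · set M : (Fin 3 → ℤ) × (Fin 3 → ℤ) → ℤ := fun x => (coeffDiff x).1 * u ^ 2 +
      (coeffDiff x).2.1 * u * v + (coeffDiff x).2.2 * v ^ 2 with hM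
    have hzero : ((T.filter fun x => M x = 0).card : ℝ) ≤ (2 * D) ^ 3 * (H : ℝ) ^ 3 := by
      have := card_integer_solutions_le hD u v hF.pos.ne' ?_ ?_ (T.filter fun x => M x = 0)
        ((Finset.filter_subset _ _).trans hTbox) ?_
      · exact_mod_cast this
      · intro s hs1 hs2 h0
        have h1 : (p : ℤ) ∣ v * (L + s) := by
          have e : v * (L + s) = (v * L - u) + (u + v * s) := by ring
          rw [e, h0, add_zero]
          exact hdvd
        rcases (Nat.prime_iff_prime_int.1 hp).dvd_or_dvd h1 with h2 | h2
        · exact hpv h2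
        · exact hL s hs1 hs2 h2
      · intro s hs1 hs2
        have h1 : |u + v * s| ≤ 2 * (H : ℤ) ^ 2 := by
          have hUH' : U ≤ (H : ℤ) ^ 2 := by exact_mod_cast hUH
          calc |u + v * s| ≤ |u| + |v * s| := abs_add_le _ _
            _ ≤ U + H * v := by
                refine add_le_add hF.abs_le ?_
                rw [abs_mul, abs_of_pos hF.pos, abs_of_pos (by linarith), mul_comm]
                exact mul_le_mul_of_nonneg_right hs2 hF.pos.le
            _ ≤ _ := by linarith [hF.mul_le]
        have h2 : ((u + v * s).natAbs : ℤ) ≤ 2 * (H : ℤ) ^ 2 := by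
          rwa [Int.natCast_natAbs]
        exact_mod_cast h2
      · intro x hx
        have h0 := (Finset.mem_filter.1 hx).2
        simp only [hM, coeffDiff, esymm₁, esymm₂, esymm₃] at h0
        linear_combination v * h0
    have hMne : ∀ x, ¬ M x = 0 → coeffDiff x ≠ 0 := by
      intro x hx h0
      apply hx
      simp [hM, h0]
    have himg : (((T.filter fun x => ¬ M x = 0).image coeffDiff).card : ℝ) ≤
        882 * (H : ℝ) ^ 2 := by
      refine card_small_polys_le_of_small hp.pos hH hHp hF hdvd hUH _ ?_ ?_ ?_
      · intro c hc
        obtain ⟨x, hx, rfl⟩ := Finset.mem_image.1 hc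
        exact inCoeffBox_coeffDiff (hTbox (Finset.mem_filter.1 hx).1)
      · intro c hc
        obtain ⟨x, hx, rfl⟩ := Finset.mem_image.1 hc
        exact dvd_coeffDiff (Finset.mem_filter.1 hx).1
      · intro c hc
        obtain ⟨x, hx, rfl⟩ := Finset.mem_image.1 hc
        exact (Finset.mem_filter.1 hx).2
    have hnz := card_le_of_card_image_coeffDiff_le hH hD3 (T.filter fun x => ¬ M x = 0)
      ((Finset.filter_subset _ _).trans hTbox)
      (fun x hx => hMne x (Finset.mem_filter.1 hx).2) _ himg
    have hsum : (T.card : ℝ) = ((T.filter fun x => M x = 0).card : ℝ) +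
        ((T.filter fun x => ¬ M x = 0).card : ℝ) := by
      exact_mod_cast (Finset.card_filter_add_card_filter_not _).symm
    have e : 882 * (H : ℝ) ^ 2 * (864 * (H * (D : ℝ) ^ 3)) =
        762048 * ((D : ℝ) ^ 3 * (H : ℝ) ^ 3) := by ring
    have e' : (2 * (D : ℝ)) ^ 3 * (H : ℝ) ^ 3 = 8 * ((D : ℝ) ^ 3 * (H : ℝ) ^ 3) := by ring
    linarith

/-! ### Energies of products of three intervals -/

section Energy

variable {p : ℕ} [Fact p.Prime]

open ComplexConjugate in
/-- Orthogonality of characters: the mean square over all Dirichlet characters of a character sum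
counts coincidences. -/
lemma sum_norm_sq_char_sum {ι : Type*} (V : Finset ι) (φ : ι → (ZMod p)ˣ) :
    ∑ χ : DirichletCharacter ℂ p, ‖∑ x ∈ V, χ (φ x : ZMod p)‖ ^ 2 =
      p.totient * (((V ×ˢ V).filter fun x => φ x.1 = φ x.2).card : ℝ) := by
  classical
  have h1 : ∀ χ : DirichletCharacter ℂ p, ((‖∑ x ∈ V, χ (φ x : ZMod p)‖ ^ 2 : ℝ) : ℂ) =
      ∑ x ∈ V ×ˢ V, χ ((φ x.1 : ZMod p)⁻¹) * χ (φ x.2 : ZMod p) := by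
    intro χ
    have h2 : ∀ y : ι, conj (χ (φ y : ZMod p)) = χ ((φ y : ZMod p)⁻¹) := by
      intro y
      have := MulChar.star_apply' χ (φ y : ZMod p)
      rw [MulChar.inv_apply'] at this
      exact this
    rw [Finset.sum_product, Complex.ofReal_pow, ← Complex.conj_mul', map_sum, Finset.sum_mul_sum]
    simp_rw [h2]
  have h3 : ((∑ χ : DirichletCharacter ℂ p, ‖∑ x ∈ V, χ (φ x : ZMod p)‖ ^ 2 : ℝ) : ℂ) =
      ((p.totient * (((V ×ˢ V).filter fun x => φ x.1 = φ x.2).card : ℝ) : ℝ) : ℂ) := by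
    rw [Complex.ofReal_sum]
    simp_rw [h1]
    rw [Finset.sum_comm]
    simp_rw [DirichletCharacter.sum_char_inv_mul_char_eq ℂ (φ _).isUnit]
    rw [← Finset.sum_filter, Finset.sum_const, nsmul_eq_mul]
    simp_rw [Units.val_inj]
    push_cast
    ring
  exact_mod_cast h3

/-- The number of pairs of triples in `[1, H]` on which the product `∏ f i (s i)` agrees. -/
noncomputable def productEnergy (H : ℕ) (f : Fin 3 → ℤ → (ZMod p)ˣ) : ℕ :=
  ((tripleBox H ×ˢ tripleBox H).filter fun x => ∏ i, f i (x.1 i) = ∏ i, f i (x.2 i)).card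

lemma totient_mul_productEnergy (H : ℕ) (f : Fin 3 → ℤ → (ZMod p)ˣ) :
    (p.totient : ℝ) * productEnergy H f = ∑ χ : DirichletCharacter ℂ p,
      ∏ i, ‖∑ s ∈ Finset.Icc (1 : ℤ) H, χ (f i s : ZMod p)‖ ^ 2 := by
  rw [productEnergy, ← sum_norm_sq_char_sum (tripleBox H) fun s => ∏ i, f i (s i)]
  refine Finset.sum_congr rfl fun χ _ => ?_
  rw [Finset.prod_pow, ← norm_prod, Finset.prod_univ_sum]
  simp [tripleBox]

/-- Hölder's inequality for energies, in the form of the inequality of arithmetic and geometric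
means for the sixth moments of the three character sums. -/
lemma productEnergy_le_mean (H : ℕ) (f : Fin 3 → ℤ → (ZMod p)ˣ) :
    (productEnergy H f : ℝ) ≤ (∑ i, (productEnergy H fun _ => f i : ℝ)) / 3 := by
  have htot : (0 : ℝ) < p.totient := by
    exact_mod_cast Nat.totient_pos.2 (Fact.out : p.Prime).pos
  refine le_of_mul_le_mul_left ?_ htot
  rw [mul_div_assoc', Finset.mul_sum]
  simp_rw [totient_mul_productEnergy]
  rw [Finset.sum_comm, Finset.sum_div]
  refine Finset.sum_le_sum fun χ _ => ?_
  simp only [Fin.prod_univ_three, Fin.sum_univ_three]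
  have key : ∀ x y z : ℝ, 0 ≤ x → 0 ≤ y → 0 ≤ z →
      x * y * z ≤ (x * x * x + y * y * y + z * z * z) / 3 := by
    intro x y z hx hy hz
    nlinarith [mul_nonneg (add_nonneg (add_nonneg hx hy) hz)
      (add_nonneg (add_nonneg (sq_nonneg (x - y)) (sq_nonneg (y - z))) (sq_nonneg (x - z)))]
  exact key _ _ _ (by positivity) (by positivity) (by positivity)

/-- The set `A` of units contains the reductions of `L + 1, …, L + H` for some integer `L`. -/
def ContainsInterval (H : ℕ) (A : Finset (ZMod p)ˣ) : Prop :=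
  ∃ L : ℤ, ∀ s : ℤ, 1 ≤ s → s ≤ H → ∃ a ∈ A, (a : ZMod p) = ((L + s : ℤ) : ZMod p)

lemma ContainsInterval.exists_fun {H : ℕ} {A : Finset (ZMod p)ˣ} (h : ContainsInterval H A) :
    ∃ (L : ℤ) (f : ℤ → (ZMod p)ˣ), ∀ s : ℤ, 1 ≤ s → s ≤ H →
      f s ∈ A ∧ (f s : ZMod p) = ((L + s : ℤ) : ZMod p) := by
  classical
  obtain ⟨L, h⟩ := h
  choose! f hf using h
  exact ⟨L, f, hf⟩

lemma productEnergy_const_le {H : ℕ} {L : ℤ} {f : ℤ → (ZMod p)ˣ}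
    (hf : ∀ s : ℤ, 1 ≤ s → s ≤ H → (f s : ZMod p) = ((L + s : ℤ) : ZMod p)) :
    productEnergy H (fun _ : Fin 3 => f) ≤ (tripleSolutions p H L).card := by
  refine Finset.card_le_card fun x hx => ?_
  obtain ⟨hx, he⟩ := Finset.mem_filter.1 hx
  refine Finset.mem_filter.2 ⟨hx, ?_⟩
  obtain ⟨hs, ht⟩ := Finset.mem_product.1 hx
  rw [mem_tripleBox] at hs ht
  rw [Fin.prod_univ_three, Fin.prod_univ_three] at he
  have h := congrArg (Units.val : (ZMod p)ˣ → ZMod p) he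
  simp only [Units.val_mul] at h
  simp only [hf _ (hs _).1 (hs _).2, hf _ (ht _).1 (ht _).2] at h
  rw [← ZMod.intCast_zmod_eq_zero_iff_dvd]
  push_cast at h ⊢
  rw [h, sub_self]

lemma card_sq_le_card_image_mul {α β : Type*} [DecidableEq β] (V : Finset α) (φ : α → β) :
    V.card ^ 2 ≤ (V.image φ).card * ((V ×ˢ V).filter fun x => φ x.1 = φ x.2).card := by
  classical
  have h1 : ((V ×ˢ V).filter fun x => φ x.1 = φ x.2).card =
      ∑ b ∈ V.image φ, (V.filter fun x => φ x = b).card ^ 2 := by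
    rw [Finset.card_eq_sum_card_fiberwise (f := fun x => φ x.1) (t := V.image φ)]
    · refine Finset.sum_congr rfl fun b _ => ?_
      rw [sq, ← Finset.card_product]
      congr 1
      ext x
      simp only [Finset.mem_filter, Finset.mem_product]
      constructor
      · rintro ⟨⟨⟨h1, h2⟩, h3⟩, h4⟩
        exact ⟨⟨h1, h4⟩, h2, h3 ▸ h4⟩
      · rintro ⟨⟨h1, h2⟩, h3, h4⟩
        exact ⟨⟨⟨h1, h3⟩, h2.trans h4.symm⟩, h2⟩
    · intro x hx
      exact Finset.mem_image_of_mem _ (Finset.mem_product.1 (Finset.mem_filter.1 hx).1).1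
  rw [h1, Finset.card_eq_sum_card_image φ V]
  exact sq_sum_le_card_mul_sum_sq

/-- The product of three intervals of length `H ≤ p ^ (1 / 4)` has essentially `H³` elements. -/
theorem pow_three_le_card_mul_mul {H D : ℕ} (hH : 1 ≤ H) (hHp : H ^ 4 ≤ p) (hpH : p ≤ H ^ 5)
    (hD : DivisorBound (8 * H ^ 6) D) {A B C : Finset (ZMod p)ˣ} (hA : ContainsInterval H A)
    (hB : ContainsInterval H B) (hC : ContainsInterval H C) :
    (H : ℝ) ^ 3 ≤ 10 ^ 6 * (D : ℝ) ^ 3 * ((A * B * C).card : ℝ) := by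
  classical
  have hp : p.Prime := Fact.out
  have hHr : (1 : ℝ) ≤ H := by exact_mod_cast hH
  obtain ⟨L₀, f₀, h₀⟩ := hA.exists_fun
  obtain ⟨L₁, f₁, h₁⟩ := hB.exists_fun
  obtain ⟨L₂, f₂, h₂⟩ := hC.exists_fun
  have hE : ∀ (L : ℤ) (f : ℤ → (ZMod p)ˣ), (∀ s : ℤ, 1 ≤ s → s ≤ H →
      (f s : ZMod p) = ((L + s : ℤ) : ZMod p)) →
      (productEnergy H (fun _ : Fin 3 => f) : ℝ) ≤ 10 ^ 6 * ((D : ℝ) ^ 3 * (H : ℝ) ^ 3) := by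
    intro L f hf
    refine le_trans (by exact_mod_cast productEnergy_const_le hf)
      (card_tripleSolutions_le hp hH hHp hpH hD L fun s hs1 hs2 hdvd => ?_)
    have := hf s hs1 hs2
    rw [(ZMod.intCast_zmod_eq_zero_iff_dvd _ _).2 hdvd] at this
    exact (f s).ne_zero this
  set f : Fin 3 → ℤ → (ZMod p)ˣ := ![f₀, f₁, f₂] with hf
  have hmean := productEnergy_le_mean H f
  simp only [Fin.sum_univ_three, hf, Matrix.cons_val_zero, Matrix.cons_val_one,
    Matrix.cons_val_two, Matrix.head_cons, Matrix.tail_cons] at hmean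
  have hE0 := hE L₀ f₀ fun s a b => (h₀ s a b).2
  have hE1 := hE L₁ f₁ fun s a b => (h₁ s a b).2
  have hE2 := hE L₂ f₂ fun s a b => (h₂ s a b).2
  rw [← hf] at hmean
  have hfE : (productEnergy H f : ℝ) ≤ 10 ^ 6 * ((D : ℝ) ^ 3 * (H : ℝ) ^ 3) := by linarith
  have hsub : (tripleBox H).image (fun s => ∏ i, f i (s i)) ⊆ A * B * C := by
    intro y hy
    obtain ⟨s, hs, rfl⟩ := Finset.mem_image.1 hy
    rw [mem_tripleBox] at hs
    rw [Fin.prod_univ_three]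
    exact Finset.mul_mem_mul (Finset.mul_mem_mul (h₀ _ (hs 0).1 (hs 0).2).1
      (h₁ _ (hs 1).1 (hs 1).2).1) (h₂ _ (hs 2).1 (hs 2).2).1
  have hcs := (card_sq_le_card_image_mul (tripleBox H) fun s => ∏ i, f i (s i)).trans
    (Nat.mul_le_mul_right _ (Finset.card_le_card hsub))
  rw [card_tripleBox] at hcs
  change (H ^ 3) ^ 2 ≤ (A * B * C).card * productEnergy H f at hcs
  have hcs' : ((H : ℝ) ^ 3) ^ 2 ≤ ((A * B * C).card : ℝ) * productEnergy H f := by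
    exact_mod_cast hcs
  have hH3 : (0 : ℝ) < (H : ℝ) ^ 3 := by positivity
  refine le_of_mul_le_mul_right ?_ hH3
  calc (H : ℝ) ^ 3 * (H : ℝ) ^ 3 = ((H : ℝ) ^ 3) ^ 2 := by ring
    _ ≤ ((A * B * C).card : ℝ) * productEnergy H f := hcs'
    _ ≤ ((A * B * C).card : ℝ) * (10 ^ 6 * ((D : ℝ) ^ 3 * (H : ℝ) ^ 3)) := by gcongr
    _ = _ := by ring

end Energy

/-! ### Multiplication by an initial interval -/

section Growth

variable {p : ℕ} [Fact p.Prime]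

/-- If `M ^ k < p`, then the residues `1, …, M` have essentially `M ^ k` distinct `k`-fold
products: these products are determined as integers, and the divisor bound applies. -/
lemma pow_le_card_pow {M k D : ℕ} (hM : M ^ k < p) (hD : DivisorBound p D)
    (J : Finset (ZMod p)ˣ) (hJ : ∀ n : ℕ, 1 ≤ n → n ≤ M → ∃ j ∈ J, (j : ZMod p) = n) :
    M ^ k ≤ D ^ k * (J ^ k).card := by
  classical
  choose! f hfJ hf using hJ
  have hV : (Fintype.piFinset fun _ : Fin k => Finset.Icc 1 M).card = M ^ k := by
    simp
  have hmem : ∀ {x : Fin k → ℕ}, (x ∈ Fintype.piFinset fun _ : Fin k => Finset.Icc 1 M) →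
      ∀ i, 1 ≤ x i ∧ x i ≤ M := fun hx i => Finset.mem_Icc.1 (Fintype.mem_piFinset.1 hx i)
  have hprod : ∀ {x : Fin k → ℕ}, (x ∈ Fintype.piFinset fun _ : Fin k => Finset.Icc 1 M) →
      ((∏ i, f (x i) : (ZMod p)ˣ) : ZMod p) = ((∏ i, x i : ℕ) : ZMod p) ∧ ∏ i, x i < p ∧
        ∏ i, x i ≠ 0 := by
    intro x hx
    refine ⟨?_, ?_, ?_⟩
    · rw [Units.coe_prod, Nat.cast_prod]
      exact Finset.prod_congr rfl fun i _ => hf _ (hmem hx i).1 (hmem hx i).2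
    · refine lt_of_le_of_lt ?_ hM
      calc ∏ i, x i ≤ ∏ _i : Fin k, M := Finset.prod_le_prod' fun i _ => (hmem hx i).2
        _ = M ^ k := by simp
    · exact Finset.prod_ne_zero_iff.2 fun i _ => (Nat.one_le_iff_ne_zero.1 (hmem hx i).1)
  rw [← hV]
  refine Finset.card_le_mul_card_image_of_maps_to (f := fun x => ∏ i, f (x i)) ?_ _ ?_
  · intro x hx
    rw [Finset.mem_pow]
    exact ⟨fun i => ⟨f (x i), hfJ _ (hmem hx i).1 (hmem hx i).2⟩, by rw [List.prod_ofFn]⟩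
  · intro b _
    set F := (Fintype.piFinset fun _ : Fin k => Finset.Icc 1 M).filter
      fun x => ∏ i, f (x i) = b with hF
    rcases F.eq_empty_or_nonempty with h0 | ⟨y, hy⟩
    · simp [h0]
    obtain ⟨hyV, hyb⟩ := Finset.mem_filter.1 hy
    have hsub : F ⊆ Fintype.piFinset fun _ : Fin k => (∏ i, y i).divisors := by
      intro x hx
      obtain ⟨hxV, hxb⟩ := Finset.mem_filter.1 hx
      have h1 : ((∏ i, x i : ℕ) : ZMod p) = ((∏ i, y i : ℕ) : ZMod p) := by
        rw [← (hprod hxV).1, ← (hprod hyV).1, hxb, hyb]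
      have h2 : ∏ i, x i = ∏ i, y i := by
        rw [ZMod.natCast_eq_natCast_iff] at h1
        exact h1.eq_of_lt_of_lt (hprod hxV).2.1 (hprod hyV).2.1
      rw [Fintype.mem_piFinset]
      intro i
      rw [Nat.mem_divisors, ← h2]
      exact ⟨Finset.dvd_prod_of_mem _ (Finset.mem_univ i), (hprod hxV).2.2⟩
    refine (Finset.card_le_card hsub).trans ?_
    rw [Fintype.card_piFinset_const]
    exact Nat.pow_le_pow_left (hD _ (hprod hyV).2.2 (hprod hyV).2.1.le) k

/-- Plünnecke's inequality, read as a lower bound for `Y * J`. -/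
lemma card_pow_mul_le_card_mul_pow {G : Type*} [CommGroup G] [DecidableEq G] (Y J : Finset G)
    (hY : Y.Nonempty) {k : ℕ} (hk : 1 ≤ k) :
    (J ^ k).card * Y.card ^ (k - 1) ≤ (Y * J).card ^ k := by
  have h := Finset.pluennecke_ruzsa_inequality_pow_mul hY J k
  have hY0 : (0 : ℚ≥0) < Y.card := by exact_mod_cast hY.card_pos
  have h1 : ((J ^ k).card : ℚ≥0) * (Y.card : ℚ≥0) ^ (k - 1) ≤ ((Y * J).card : ℚ≥0) ^ k := by
    calc _ ≤ (((Y * J).card : ℚ≥0) / Y.card) ^ k * Y.card * (Y.card : ℚ≥0) ^ (k - 1) := by gcongr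
      _ = (((Y * J).card : ℚ≥0) / Y.card) ^ k * (Y.card : ℚ≥0) ^ k := by
          rw [mul_assoc, mul_pow_sub_one (by omega)]
      _ = _ := by rw [← mul_pow, div_mul_cancel₀ _ hY0.ne']
  exact_mod_cast h1

/-! ### A bilinear equation -/

/-- The number of points `(x, y)` of `P` on the line `a m x + b n y = c` with parameters
`l = (m, n)`. The degenerate parameters are allowed, which makes the mean exact. -/
noncomputable def lineCount (a b c : ZMod p) (P : Finset ((ZMod p)ˣ × (ZMod p)ˣ))
    (l : ZMod p × ZMod p) : ℕ :=
  (P.filter fun z => a * l.1 * z.1 + b * l.2 * z.2 = c).card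

lemma card_lines_through {a b : ZMod p} (ha : a ≠ 0) (c : ZMod p) (z : (ZMod p)ˣ × (ZMod p)ˣ) :
    ((Finset.univ : Finset (ZMod p × ZMod p)).filter
      fun l => a * l.1 * z.1 + b * l.2 * z.2 = c).card = p := by
  have h : ((Finset.univ : Finset (ZMod p × ZMod p)).filter
      fun l => a * l.1 * z.1 + b * l.2 * z.2 = c).card = (Finset.univ : Finset (ZMod p)).card := by
    have hz : (z.1 : ZMod p) ≠ 0 := z.1.ne_zero
    refine Finset.card_nbij' (fun l => l.2) (fun k => ((c - b * k * z.2) / (a * z.1), k))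
      ?_ ?_ ?_ ?_
    · intro l _; simp
    · intro k _
      simp only [Finset.coe_filter, Finset.mem_univ, true_and, Set.mem_ofPred_eq]
      field_simp
      ring
    · intro l hl
      simp only [Finset.coe_filter, Finset.mem_univ, true_and, Set.mem_ofPred_eq] at hl
      refine Prod.ext ?_ rfl
      simp only
      rw [← hl]
      field_simp
      ring
    · intro k _; rfl
  rw [h, Finset.card_univ, ZMod.card]

lemma card_lines_through_two_le_one {a b c : ZMod p} (ha : a ≠ 0) (hb : b ≠ 0) (hc : c ≠ 0)
    {z w : (ZMod p)ˣ × (ZMod p)ˣ} (hzw : z ≠ w) :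
    ((Finset.univ : Finset (ZMod p × ZMod p)).filter fun l =>
      a * l.1 * z.1 + b * l.2 * z.2 = c ∧ a * l.1 * w.1 + b * l.2 * w.2 = c).card ≤ 1 := by
  rw [Finset.card_le_one]
  intro l hl m hm
  obtain ⟨-, h1, h2⟩ := Finset.mem_filter.1 hl
  obtain ⟨-, h3, h4⟩ := Finset.mem_filter.1 hm
  -- proportional points lie on a common line with `c ≠ 0` only if they are equal
  have hdet : (z.1 : ZMod p) * w.2 - w.1 * z.2 ≠ 0 := by
    intro h0
    apply hzw
    have e2 : c * ((w.2 : ZMod p) - z.2) = 0 := by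
      linear_combination a * l.1 * h0 - (w.2 : ZMod p) * h1 + (z.2 : ZMod p) * h2
    have h5 : (z.2 : ZMod p) = w.2 :=
      (sub_eq_zero.1 ((mul_eq_zero.1 e2).resolve_left hc)).symm
    have e1 : ((z.1 : ZMod p) - w.1) * w.2 = 0 := by
      rw [h5] at h0
      linear_combination h0
    have h6 : (z.1 : ZMod p) = w.1 :=
      sub_eq_zero.1 ((mul_eq_zero.1 e1).resolve_right w.2.ne_zero)
    exact Prod.ext (Units.ext h6) (Units.ext h5)
  have k1 : a * (l.1 - m.1) * ((z.1 : ZMod p) * w.2 - w.1 * z.2) = 0 := by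
    linear_combination (w.2 : ZMod p) * (h1 - h3) - (z.2 : ZMod p) * (h2 - h4)
  have k2 : b * (l.2 - m.2) * ((z.1 : ZMod p) * w.2 - w.1 * z.2) = 0 := by
    linear_combination (z.1 : ZMod p) * (h2 - h4) - (w.1 : ZMod p) * (h1 - h3)
  refine Prod.ext (sub_eq_zero.1 ?_) (sub_eq_zero.1 ?_)
  · exact (mul_eq_zero.1 ((mul_eq_zero.1 k1).resolve_right hdet)).resolve_left ha
  · exact (mul_eq_zero.1 ((mul_eq_zero.1 k2).resolve_right hdet)).resolve_left hb

lemma sum_lineCount {a b : ZMod p} (ha : a ≠ 0) (c : ZMod p)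
    (P : Finset ((ZMod p)ˣ × (ZMod p)ˣ)) :
    ∑ l, lineCount a b c P l = P.card * p := by
  simp only [lineCount, Finset.card_filter]
  rw [Finset.sum_comm]
  simp only [← Finset.card_filter, card_lines_through ha, Finset.sum_const, smul_eq_mul]

lemma sum_lineCount_sq_le {a b c : ZMod p} (ha : a ≠ 0) (hb : b ≠ 0) (hc : c ≠ 0)
    (P : Finset ((ZMod p)ˣ × (ZMod p)ˣ)) :
    ∑ l, lineCount a b c P l ^ 2 ≤ P.card * p + P.card ^ 2 := by
  classical
  have h1 : ∀ l, lineCount a b c P l ^ 2 = ∑ x ∈ P ×ˢ P,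
      if a * l.1 * x.1.1 + b * l.2 * x.1.2 = c ∧ a * l.1 * x.2.1 + b * l.2 * x.2.2 = c
        then 1 else 0 := by
    intro l
    rw [lineCount, sq, ← Finset.card_product, ← Finset.filter_product, Finset.card_filter]
  simp_rw [h1]
  rw [Finset.sum_comm]
  simp only [← Finset.card_filter]
  have h2 : ∀ x ∈ P ×ˢ P, ((Finset.univ : Finset (ZMod p × ZMod p)).filter fun l =>
      a * l.1 * x.1.1 + b * l.2 * x.1.2 = c ∧ a * l.1 * x.2.1 + b * l.2 * x.2.2 = c).card ≤
      (if x.1 = x.2 then p else 0) + 1 := by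
    intro x _
    by_cases hx : x.1 = x.2
    · rw [if_pos hx]
      refine (Finset.card_le_card fun l hl => ?_).trans
        ((card_lines_through (b := b) ha c x.1).le.trans (Nat.le_succ p))
      exact Finset.mem_filter.2 ⟨Finset.mem_univ _, (Finset.mem_filter.1 hl).2.1⟩
    · rw [if_neg hx, zero_add]
      exact card_lines_through_two_le_one ha hb hc hx
  refine (Finset.sum_le_sum h2).trans ?_
  rw [Finset.sum_add_distrib, ← Finset.sum_filter, Finset.sum_const, Finset.sum_const]
  have h3 : ((P ×ˢ P).filter fun x => x.1 = x.2).card = P.card := by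
    rw [← Finset.diag_eq_filter, Finset.diag_card]
  rw [h3, Finset.card_product]
  simp [sq]

/-- The equation `a x₁ x₂ + b x₃ x₄ = c` is solvable in sets the product of whose sizes exceeds
`p³`: the number of points of `X₁ × X₃` on a line `a m x + b n y = c` has small variance. -/
theorem exists_bilinear_eq {a b c : ZMod p} (ha : a ≠ 0) (hb : b ≠ 0) (hc : c ≠ 0)
    (X₁ X₂ X₃ X₄ : Finset (ZMod p)ˣ)
    (h : (p : ℝ) ^ 3 < X₁.card * X₂.card * (X₃.card * X₄.card)) :
    ∃ x₁ ∈ X₁, ∃ x₂ ∈ X₂, ∃ x₃ ∈ X₃, ∃ x₄ ∈ X₄,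
      a * ((x₁ : ZMod p) * x₂) + b * ((x₃ : ZMod p) * x₄) = c := by
  classical
  by_contra hno
  push Not at hno
  have hp : (0 : ℝ) < p := by exact_mod_cast (Fact.out : p.Prime).pos
  set P := X₁ ×ˢ X₃ with hP
  set r : ZMod p × ZMod p → ℝ := fun l => lineCount a b c P l with hr
  set n : ℝ := (P.card : ℝ) with hn
  have hn0 : 0 ≤ n := Nat.cast_nonneg _
  have hs1 : ∑ l, r l = n * p := by
    have := sum_lineCount (b := b) ha c P
    simp only [hr, hn]
    exact_mod_cast this
  have hs2 : ∑ l, r l ^ 2 ≤ n * p + n ^ 2 := by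
    have := sum_lineCount_sq_le ha hb hc P
    simp only [hr, hn]
    exact_mod_cast this
  have hvar : ∑ l, (r l - n / p) ^ 2 ≤ n * p := by
    have e : ∑ l, (r l - n / p) ^ 2 = ∑ l, r l ^ 2 - 2 * (n / p) * ∑ l, r l +
        (p : ℝ) ^ 2 * (n / p) ^ 2 := by
      simp only [sub_sq]
      rw [Finset.sum_add_distrib, Finset.sum_sub_distrib, Finset.sum_const, Finset.card_univ,
        Fintype.card_prod, ZMod.card, nsmul_eq_mul, Finset.mul_sum]
      push_cast
      rw [sq (p : ℝ)]
      congr 2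
      exact Finset.sum_congr rfl fun l _ => by ring
    rw [e, hs1]
    have e2 : 2 * (n / p) * (n * p) = 2 * n ^ 2 := by field_simp
    have e3 : (p : ℝ) ^ 2 * (n / p) ^ 2 = n ^ 2 := by field_simp
    rw [e2, e3]
    linarith
  set Q : Finset (ZMod p × ZMod p) :=
    (X₂ ×ˢ X₄).image fun z => ((z.1 : ZMod p), (z.2 : ZMod p)) with hQ
  have hQcard : (Q.card : ℝ) = X₂.card * X₄.card := by
    rw [hQ, Finset.card_image_of_injective, Finset.card_product]
    · push_cast; rfl
    · intro z w hzw
      exact Prod.ext (Units.ext (congrArg Prod.fst hzw)) (Units.ext (congrArg Prod.snd hzw))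
  have hrQ : ∀ l ∈ Q, r l = 0 := by
    intro l hl
    obtain ⟨z, hz, rfl⟩ := Finset.mem_image.1 hl
    obtain ⟨hz1, hz2⟩ := Finset.mem_product.1 hz
    simp only [hr, lineCount, Nat.cast_eq_zero, Finset.card_eq_zero]
    refine Finset.filter_false_of_mem fun w hw hw' => ?_
    obtain ⟨hw1, hw2⟩ := Finset.mem_product.1 hw
    refine hno w.1 hw1 z.1 hz1 w.2 hw2 z.2 hz2 ?_
    linear_combination hw'
  have hlow : (Q.card : ℝ) * (n / p) ^ 2 ≤ n * p := by
    refine le_trans ?_ hvar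
    calc (Q.card : ℝ) * (n / p) ^ 2 = ∑ l ∈ Q, (r l - n / p) ^ 2 := by
          rw [Finset.sum_congr rfl fun l hl => by rw [hrQ l hl, zero_sub, neg_sq],
            Finset.sum_const, nsmul_eq_mul]
      _ ≤ _ := Finset.sum_le_sum_of_subset_of_nonneg (Finset.subset_univ _)
          fun l _ _ => sq_nonneg _
  have hnX : n = X₁.card * X₃.card := by rw [hn, hP, Finset.card_product]; push_cast; rfl
  have hnQ : (p : ℝ) ^ 3 < Q.card * n := by
    rw [hQcard, hnX]
    calc _ < _ := h
      _ = _ := by ring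
  have hn1 : 0 < n := by
    rcases hn0.eq_or_lt with h0 | h0
    · rw [← h0, mul_zero] at hnQ
      exact absurd hnQ (not_lt.2 (by positivity))
    · exact h0
  have h5 : (Q.card : ℝ) * n * n ≤ (p : ℝ) ^ 3 * n := by
    have e : (Q.card : ℝ) * (n / p) ^ 2 = Q.card * n * n / p ^ 2 := by field_simp
    rw [e, div_le_iff₀ (by positivity)] at hlow
    calc _ ≤ _ := hlow
      _ = _ := by ring
  exact absurd (le_of_mul_le_mul_right h5 hn1) (not_le.2 hnQ)

end Growth

/-! ### Residue intervals as sets of units -/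

section Intervals

variable {p : ℕ} [Fact p.Prime]

open Classical in
/-- The units of `ZMod p` that lie in a given set. -/
noncomputable def unitsIn (S : Set (ZMod p)) : Finset (ZMod p)ˣ :=
  Finset.univ.filter fun u => (u : ZMod p) ∈ S

lemma mem_unitsIn {S : Set (ZMod p)} {u : (ZMod p)ˣ} : u ∈ unitsIn S ↔ (u : ZMod p) ∈ S := by
  simp [unitsIn]

lemma exists_mem_unitsIn {S : Set (ZMod p)} (h0 : (0 : ZMod p) ∉ S) {x : ZMod p} (hx : x ∈ S) :
    ∃ u ∈ unitsIn S, (u : ZMod p) = x := by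
  have hx0 : x ≠ 0 := fun h => h0 (h ▸ hx)
  exact ⟨Units.mk0 x hx0, mem_unitsIn.2 hx, rfl⟩

lemma ncard_interval_le (L N : ℤ) :
    (((fun n : ℤ => (n : ZMod p)) '' Set.Icc (L + 1) (L + N)).ncard : ℤ) ≤ max N 0 := by
  have h1 := Set.ncard_image_le (f := fun n : ℤ => (n : ZMod p)) (Set.finite_Icc (L + 1) (L + N))
  have h2 : (Set.Icc (L + 1) (L + N)).ncard = N.toNat := by
    rw [← Finset.coe_Icc, Set.ncard_coe_finset, Int.card_Icc]
    congr 1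
    ring
  rw [h2] at h1
  have h3 : (N.toNat : ℤ) = max N 0 := by omega
  rw [← h3]
  exact_mod_cast h1

lemma containsInterval_unitsIn {I : Set (ZMod p)} (hI : IsResidueInterval p I)
    (h0 : (0 : ZMod p) ∉ I) {H : ℕ} (hH : H ≤ I.ncard) : ContainsInterval H (unitsIn I) := by
  obtain ⟨L, N, hN, rfl⟩ := hI
  refine ⟨L, fun s hs1 hs2 => exists_mem_unitsIn h0 ⟨L + s, ?_, rfl⟩⟩
  have h1 := ncard_interval_le (p := p) L N
  have h2 : (H : ℤ) ≤ max N 0 := le_trans (by exact_mod_cast hH) h1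
  rw [Set.mem_Icc]
  omega

/-- An interval that contains `1` but not `0` starts at `1`. -/
lemma natCast_mem_of_one_mem {I : Set (ZMod p)} (hI : IsResidueInterval p I)
    (h0 : (0 : ZMod p) ∉ I) (h1 : (1 : ZMod p) ∈ I) {n : ℕ} (hn1 : 1 ≤ n) (hn : n ≤ I.ncard) :
    (n : ZMod p) ∈ I := by
  obtain ⟨L, N, hN, rfl⟩ := hI
  obtain ⟨m, hm, hm1⟩ := h1
  have hcard := ncard_interval_le (p := p) L N
  simp only at hm1
  rw [Set.mem_Icc] at hm
  have hmL : m = L + 1 := by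
    by_contra hne
    refine h0 ⟨m - 1, Set.mem_Icc.2 ⟨by omega, by omega⟩, ?_⟩
    push_cast
    rw [hm1, sub_self]
  refine ⟨L + n, Set.mem_Icc.2 ⟨by omega, by omega⟩, ?_⟩
  have hL : ((L : ℤ) : ZMod p) = 0 := by
    rw [hmL] at hm1
    push_cast at hm1
    linear_combination hm1
  simp [hL]

end Intervals

/-! ### Combining the bounds -/

/-- The size of a product of three intervals as a power of `q = p`. -/
lemma rpow_le_of_pow_three_le {q C D H x θ : ℝ} (hq : 1 ≤ q)
    (hD0 : 0 < D) (hD : D ≤ C * q ^ (θ / 12)) (hH : q ^ (1 / 4 - θ / 12) / 2 ≤ H)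
    (hx : H ^ 3 ≤ 10 ^ 6 * D ^ 3 * x) (hlarge : 8 * 10 ^ 6 * C ^ 3 ≤ q ^ (θ / 2)) :
    q ^ (3 / 4 - θ) ≤ x := by
  have hq0 : 0 < q := by linarith
  have hpow : ∀ s : ℝ, (q ^ s) ^ 3 = q ^ (3 * s) := fun s => by
    rw [← Real.rpow_natCast (q ^ s), ← Real.rpow_mul hq0.le]
    congr 1
    push_cast
    ring
  have hmain : q ^ (3 / 4 - θ) * (10 ^ 6 * D ^ 3) ≤ 10 ^ 6 * D ^ 3 * x := by
    calc q ^ (3 / 4 - θ) * (10 ^ 6 * D ^ 3)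
        ≤ q ^ (3 / 4 - θ) * (10 ^ 6 * (C * q ^ (θ / 12)) ^ 3) := by gcongr
      _ = q ^ (3 / 4 - θ) * q ^ (θ / 4) * (10 ^ 6 * C ^ 3) := by
          rw [mul_pow, hpow]
          rw [show 3 * (θ / 12) = θ / 4 by ring]
          ring
      _ ≤ q ^ (3 / 4 - θ) * q ^ (θ / 4) * (q ^ (θ / 2) / 8) := by
          gcongr
          linarith
      _ = (q ^ (1 / 4 - θ / 12) / 2) ^ 3 := by
          rw [div_pow, hpow, ← Real.rpow_add hq0, mul_div_assoc', ← Real.rpow_add hq0]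
          congr 1
          · congr 1
            ring
          · norm_num
      _ ≤ H ^ 3 := by gcongr
      _ ≤ _ := hx
  rw [mul_comm] at hmain
  exact le_of_mul_le_mul_left hmain (by positivity)

/-- The growth of a set of size `y` under multiplication by an initial interval whose `k`-fold
product set has `j` elements, as a power of `q = p`. -/
lemma rpow_le_of_pow_mul_le {q j y w θ : ℝ} {k : ℕ} (hq : 1 ≤ q) (hk : 1 ≤ k) (hw : 0 ≤ w)
    (hj : q ^ (1 - θ) ≤ j) (hy : q ^ (3 / 4 - θ) ≤ y) (h : j * y ^ (k - 1) ≤ w ^ k) :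
    q ^ (3 / 4 + 1 / (4 * k) - θ : ℝ) ≤ w := by
  have hq0 : 0 < q := by linarith
  have hk0 : (0 : ℝ) < k := by exact_mod_cast hk
  have hj0 : 0 ≤ j := le_trans (by positivity) hj
  refine le_of_pow_le_pow_left₀ (n := k) (by omega) hw ?_
  calc (q ^ (3 / 4 + 1 / (4 * k) - θ : ℝ)) ^ k
      = q ^ (1 - θ) * (q ^ (3 / 4 - θ)) ^ (k - 1) := by
        rw [← Real.rpow_natCast, ← Real.rpow_natCast, ← Real.rpow_mul hq0.le,
          ← Real.rpow_mul hq0.le, ← Real.rpow_add hq0, Nat.cast_sub hk]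
        congr 1
        push_cast
        field_simp
        ring
    _ ≤ j * y ^ (k - 1) := by gcongr
    _ ≤ _ := h

/-- The size of the `k`-fold product set of an initial interval as a power of `q = p`. -/
lemma rpow_le_of_pow_le_pow_mul {q C D M j θ : ℝ} {k : ℕ} (hq : 1 ≤ q)
    (hk : 1 ≤ k) (hC : 1 ≤ C) (hD0 : 0 < D) (hD : D ≤ C * q ^ (θ / (2 * k)))
    (hM : q ^ (1 / k : ℝ) / 2 ≤ M) (hj : M ^ k ≤ D ^ k * j)
    (hlarge : (2 * C) ^ k ≤ q ^ (θ / 2)) : q ^ (1 - θ) ≤ j := by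
  have hq0 : 0 < q := by linarith
  have hk0 : (0 : ℝ) < k := by exact_mod_cast hk
  have hmain : D ^ k * q ^ (1 - θ) ≤ D ^ k * j := by
    calc D ^ k * q ^ (1 - θ) ≤ (C * q ^ (θ / (2 * k))) ^ k * q ^ (1 - θ) := by gcongr
      _ = (2 * C) ^ k * (q ^ (θ / 2) * q ^ (1 - θ)) / 2 ^ k := by
          rw [mul_pow, mul_pow, ← Real.rpow_natCast (q ^ _), ← Real.rpow_mul hq0.le]
          rw [show θ / (2 * k) * k = θ / 2 by field_simp]
          field_simp
      _ ≤ q ^ (θ / 2) * (q ^ (θ / 2) * q ^ (1 - θ)) / 2 ^ k := by gcongr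
      _ = (q ^ (1 / k : ℝ) / 2) ^ k := by
          rw [← Real.rpow_add hq0, ← Real.rpow_add hq0, div_pow, ← Real.rpow_natCast (q ^ _),
            ← Real.rpow_mul hq0.le]
          congr 2
          field_simp
          ring
      _ ≤ M ^ k := by gcongr
      _ ≤ _ := hj
  exact le_of_mul_le_mul_left hmain (by positivity)

/-- Three sets of size about `q ^ (3 / 4)` and one that is larger by a factor `q ^ κ` are large
enough for the bilinear equation if the four losses `q ^ θ` together are less than `q ^ κ`. -/
lemma pow_three_lt_mul {q x₁ x₂ x₃ w θ κ : ℝ} (hq : 1 < q) (hκ : 4 * θ < κ)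
    (h₁ : q ^ (3 / 4 - θ) ≤ x₁) (h₂ : q ^ (3 / 4 - θ) ≤ x₂) (h₃ : q ^ (3 / 4 - θ) ≤ x₃)
    (hw : q ^ (3 / 4 + κ - θ) ≤ w) : q ^ 3 < x₁ * x₂ * (x₃ * w) := by
  have hq0 : 0 < q := by linarith
  have hs : 0 < q ^ (3 / 4 - θ) := Real.rpow_pos_of_pos hq0 _
  have ht : 0 < q ^ (3 / 4 + κ - θ) := Real.rpow_pos_of_pos hq0 _
  calc q ^ 3 = q ^ (3 : ℝ) := by exact_mod_cast (Real.rpow_natCast q 3).symm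
    _ < q ^ ((3 / 4 - θ) + (3 / 4 - θ) + ((3 / 4 - θ) + (3 / 4 + κ - θ))) :=
        Real.rpow_lt_rpow_of_exponent_lt hq (by linarith)
    _ = q ^ (3 / 4 - θ) * q ^ (3 / 4 - θ) * (q ^ (3 / 4 - θ) * q ^ (3 / 4 + κ - θ)) := by
        rw [Real.rpow_add hq0, Real.rpow_add hq0, Real.rpow_add hq0 (3 / 4 - θ) (3 / 4 + κ - θ)]
    _ ≤ x₁ * x₂ * (x₃ * w) :=
        mul_le_mul (mul_le_mul h₁ h₂ hs.le (hs.le.trans h₁))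
          (mul_le_mul h₃ hw ht.le (hs.le.trans h₃)) (by positivity)
          (mul_nonneg (hs.le.trans h₁) (hs.le.trans h₂))

lemma exists_nat_near_rpow_quarter {p : ℕ} {θ : ℝ} (hp : 1 ≤ p) (hθ0 : 0 < θ)
    (hθ1 : θ ≤ 1 / 32) (hL : 32 ≤ (p : ℝ) ^ (1 / 8 : ℝ)) :
    ∃ H : ℕ, 1 ≤ H ∧ H ^ 4 ≤ p ∧ p ≤ H ^ 5 ∧ (H : ℝ) ≤ (p : ℝ) ^ (1 / 4 - θ / 12) ∧
      (p : ℝ) ^ (1 / 4 - θ / 12) / 2 ≤ H := by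
  have hq : (1 : ℝ) ≤ p := by exact_mod_cast hp
  have hq0 : (0 : ℝ) < p := by linarith
  set H : ℕ := ⌊(p : ℝ) ^ (1 / 4 - θ / 12)⌋₊ with hH
  have hx1 : 1 ≤ (p : ℝ) ^ (1 / 4 - θ / 12) := Real.one_le_rpow hq (by linarith)
  have hHle : (H : ℝ) ≤ (p : ℝ) ^ (1 / 4 - θ / 12) := Nat.floor_le (by positivity)
  have hH1 : 1 ≤ H := Nat.one_le_floor_iff _ |>.2 hx1
  have hHge : (p : ℝ) ^ (1 / 4 - θ / 12) / 2 ≤ H := by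
    have h2 := Nat.lt_floor_add_one ((p : ℝ) ^ (1 / 4 - θ / 12))
    have h3 : (1 : ℝ) ≤ H := by exact_mod_cast hH1
    rw [← hH] at h2
    linarith
  have hH4 : H ^ 4 ≤ p := by
    have : (H : ℝ) ^ 4 ≤ p := by
      calc (H : ℝ) ^ 4 ≤ ((p : ℝ) ^ (1 / 4 - θ / 12)) ^ 4 := by gcongr
        _ = (p : ℝ) ^ (1 - θ / 3) := by
            rw [← Real.rpow_natCast, ← Real.rpow_mul hq0.le]
            congr 1
            push_cast
            ring
        _ ≤ (p : ℝ) ^ (1 : ℝ) := Real.rpow_le_rpow_of_exponent_le hq (by linarith)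
        _ = p := Real.rpow_one _
    exact_mod_cast this
  have hH5 : p ≤ H ^ 5 := by
    have : (p : ℝ) ≤ (H : ℝ) ^ 5 := by
      calc (p : ℝ) = (p : ℝ) ^ (1 : ℝ) * 32 / 32 := by rw [Real.rpow_one]; ring
        _ ≤ (p : ℝ) ^ (1 : ℝ) * (p : ℝ) ^ (1 / 8 : ℝ) / 32 := by gcongr
        _ = (p : ℝ) ^ (9 / 8 : ℝ) / 32 := by rw [← Real.rpow_add hq0]; norm_num
        _ ≤ (p : ℝ) ^ ((1 / 4 - θ / 12) * (5 : ℕ)) / 32 := by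
            gcongr ?_ / _
            refine Real.rpow_le_rpow_of_exponent_le hq ?_
            push_cast
            linarith
        _ = ((p : ℝ) ^ (1 / 4 - θ / 12) / 2) ^ 5 := by
            rw [Real.rpow_mul hq0.le, Real.rpow_natCast, div_pow]
            norm_num
        _ ≤ _ := by gcongr
    exact_mod_cast this
  exact ⟨H, hH1, hH4, hH5, hHle, hHge⟩

lemma exists_nat_near_rpow_one_div {p k : ℕ} (hp : 1 ≤ p) (hk : 1 ≤ k)
    (hL : 2 ≤ (p : ℝ) ^ (1 / k : ℝ)) :
    ∃ M : ℕ, (M : ℝ) < (p : ℝ) ^ (1 / k : ℝ) ∧ (p : ℝ) ^ (1 / k : ℝ) / 2 ≤ M ∧ M ^ k < p := by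
  have hq : (1 : ℝ) ≤ p := by exact_mod_cast hp
  have hq0 : (0 : ℝ) < p := by linarith
  have hk0 : (0 : ℝ) < k := by exact_mod_cast hk
  -- the floor would not do: `M ^ k < p` has to be strict
  set M : ℕ := ⌈(p : ℝ) ^ (1 / k : ℝ)⌉₊ - 1 with hM
  have hMpos : 0 < (p : ℝ) ^ (1 / k : ℝ) := by positivity
  have hceil : 1 ≤ ⌈(p : ℝ) ^ (1 / k : ℝ)⌉₊ := Nat.one_le_ceil_iff.2 hMpos
  have hMlt : (M : ℝ) < (p : ℝ) ^ (1 / k : ℝ) := by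
    rw [← Nat.lt_ceil]
    omega
  have hMge : (p : ℝ) ^ (1 / k : ℝ) / 2 ≤ M := by
    have h2 : (p : ℝ) ^ (1 / k : ℝ) ≤ M + 1 := by
      have h3 : (p : ℝ) ^ (1 / k : ℝ) ≤ (⌈(p : ℝ) ^ (1 / k : ℝ)⌉₊ : ℝ) := Nat.le_ceil _
      have h4 : ((M + 1 : ℕ) : ℝ) = (⌈(p : ℝ) ^ (1 / k : ℝ)⌉₊ : ℝ) := by
        congr 1
        omega
      push_cast at h4
      linarith
    linarith
  have hMk : M ^ k < p := by
    have : (M : ℝ) ^ k < p := by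
      calc (M : ℝ) ^ k < ((p : ℝ) ^ (1 / k : ℝ)) ^ k := by gcongr
        _ = p := by
            rw [← Real.rpow_natCast, ← Real.rpow_mul hq0.le, one_div_mul_cancel hk0.ne',
              Real.rpow_one]
    exact_mod_cast this
  exact ⟨M, hMlt, hMge, hMk⟩

lemma exists_divisorBound {e : ℝ} (he : 0 < e) :
    ∃ C : ℝ, 1 ≤ C ∧ ∀ p : ℕ, 1 ≤ p →
      ∃ D : ℕ, 1 ≤ D ∧ (D : ℝ) ≤ C * (p : ℝ) ^ (3 * e) ∧ DivisorBound (p ^ 3) D := by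
  obtain ⟨C, hC1, hC⟩ := exists_card_divisors_le e he
  refine ⟨C, hC1, fun p hp => ?_⟩
  have hq0 : (0 : ℝ) < p := by exact_mod_cast hp
  have hDB : DivisorBound (p ^ 3) ⌊C * (p : ℝ) ^ (3 * e)⌋₊ := by
    intro n hn hnp
    refine Nat.le_floor ((hC n hn).trans ?_)
    gcongr
    rw [Real.rpow_mul hq0.le]
    refine Real.rpow_le_rpow (by positivity) ?_ he.le
    have : ((p : ℝ) ^ (3 : ℝ)) = (p : ℝ) ^ 3 := by exact_mod_cast Real.rpow_natCast (p : ℝ) 3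
    rw [this]
    exact_mod_cast hnp
  exact ⟨_, hDB.one_le (Nat.one_le_pow _ _ hp), Nat.floor_le (by positivity), hDB⟩

lemma mem_smul_prod_add_smul_prod {p : ℕ} [Fact p.Prime] {I : ℕ → Set (ZMod p)}
    {a b c : ZMod p} {x₁ x₂ x₃ x₄ : (ZMod p)ˣ}
    (hx₁ : x₁ ∈ unitsIn (I 1) * unitsIn (I 2) * unitsIn (I 3))
    (hx₂ : x₂ ∈ unitsIn (I 4) * unitsIn (I 5) * unitsIn (I 6))
    (hx₃ : x₃ ∈ unitsIn (I 7) * unitsIn (I 8) * unitsIn (I 9))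
    (hx₄ : x₄ ∈ unitsIn (I 10) * unitsIn (I 11) * unitsIn (I 12) * unitsIn (I 13))
    (heq : a * ((x₁ : ZMod p) * x₂) + b * ((x₃ : ZMod p) * x₄) = c) :
    c ∈ a • (∏ i ∈ Finset.Icc 1 6, I i) + b • (∏ i ∈ Finset.Icc 7 13, I i) := by
  have hval : ∀ i j l : ℕ, ∀ x ∈ unitsIn (I i) * unitsIn (I j) * unitsIn (I l),
      (x : ZMod p) ∈ I i * I j * I l := by
    intro i j l x hx
    obtain ⟨y, hy, u, hu, rfl⟩ := Finset.mem_mul.1 hx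
    obtain ⟨s, hs, t, ht, rfl⟩ := Finset.mem_mul.1 hy
    exact Set.mul_mem_mul (Set.mul_mem_mul (mem_unitsIn.1 hs) (mem_unitsIn.1 ht))
      (mem_unitsIn.1 hu)
  have e6 : ∏ i ∈ Finset.Icc 1 6, I i = (I 1 * I 2 * I 3) * (I 4 * I 5 * I 6) := by
    rw [show Finset.Icc 1 6 = {1, 2, 3, 4, 5, 6} from rfl]
    simp [mul_assoc]
  have e7 : ∏ i ∈ Finset.Icc 7 13, I i =
      (I 7 * I 8 * I 9) * ((I 10 * I 11 * I 12) * I 13) := by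
    rw [show Finset.Icc 7 13 = {7, 8, 9, 10, 11, 12, 13} from rfl]
    simp [mul_assoc]
  rw [e6, e7, ← heq]
  obtain ⟨y, hy, j, hj, rfl⟩ := Finset.mem_mul.1 hx₄
  refine Set.add_mem_add (Set.smul_mem_smul_set ?_) (Set.smul_mem_smul_set ?_)
  · exact Set.mul_mem_mul (hval _ _ _ _ hx₁) (hval _ _ _ _ hx₂)
  · exact Set.mul_mem_mul (hval _ _ _ _ hx₃) (Set.mul_mem_mul (hval _ _ _ _ hy) (mem_unitsIn.1 hj))

theorem theorem2 :
    ∀ ε : ℝ, 0 < ε → ∃ δ : ℝ, 0 < δ ∧ ∃ p₀ : ℕ, ∀ p : ℕ, p.Prime → p₀ ≤ p →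
      ∀ I : ℕ → Set (ZMod p),
        (∀ i ∈ Finset.Icc 1 13, IsResidueInterval p (I i) ∧ (0 : ZMod p) ∉ I i) →
        (1 : ZMod p) ∈ I 13 →
        (∀ i ∈ Finset.Icc 1 12, (p : ℝ) ^ (1 / 4 - δ : ℝ) < ((I i).ncard : ℝ)) →
        (p : ℝ) ^ ε < ((I 13).ncard : ℝ) →
        ∀ a b c : ZMod p, a ≠ 0 → b ≠ 0 → c ≠ 0 →
          c ∈ a • (∏ i ∈ Finset.Icc 1 6, I i) + b • (∏ i ∈ Finset.Icc 7 13, I i) := by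
  intro ε hε
  -- `I 13` contains an initial interval of length about `p ^ (1 / k)`; each of the four sets in the
  -- bilinear equation may lose a factor `p ^ θ`, and `4 * θ = 1 / (8 * k)` is half of the gain
  set k : ℕ := ⌈1 / ε⌉₊ + 1 with hk
  have hk1 : 1 ≤ k := by omega
  have hk0 : (0 : ℝ) < k := by exact_mod_cast hk1
  have hk1' : (1 : ℝ) ≤ k := by exact_mod_cast hk1
  have hkε : 1 / (k : ℝ) ≤ ε := by
    rw [div_le_iff₀ hk0]
    have h1 : 1 / ε ≤ k := (Nat.le_ceil _).trans (by rw [hk]; push_cast; linarith)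
    rw [div_le_iff₀ hε] at h1
    linarith
  set θ : ℝ := 1 / (32 * k) with hθ
  have hθ0 : 0 < θ := by positivity
  have hθ1 : θ ≤ 1 / 32 := by
    rw [hθ]
    exact one_div_le_one_div_of_le (by norm_num) (by linarith)
  -- the divisor bound up to `p ^ 3` is then `p ^ (θ / (12 * k))`
  set e : ℝ := θ / (36 * k) with he
  have he0 : 0 < e := by positivity
  obtain ⟨C, hC1, hC⟩ := exists_divisorBound he0
  refine ⟨θ / 12, by positivity, ?_⟩
  have hlarge : ∀ (s K : ℝ), 0 < s → ∀ᶠ n : ℕ in Filter.atTop, K ≤ (n : ℝ) ^ s :=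
    fun s K hs => ((tendsto_rpow_atTop hs).comp tendsto_natCast_atTop_atTop).eventually_ge_atTop K
  obtain ⟨p₀, hp₀⟩ := Filter.eventually_atTop.1
    ((hlarge (θ / 2) (8 * 10 ^ 6 * C ^ 3) (by positivity)).and
      ((hlarge (θ / 2) ((2 * C) ^ k) (by positivity)).and
        ((hlarge (1 / k) 2 (by positivity)).and
          ((hlarge (1 / 8) 32 (by norm_num)).and (Filter.eventually_ge_atTop 8)))))
  refine ⟨p₀, fun p hp hpp I hI h1 hI12 hI13 a b c ha hb hc => ?_⟩
  obtain ⟨hL1, hL2, hL3, hL4, hp8⟩ := hp₀ p hpp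
  have : Fact p.Prime := ⟨hp⟩
  have hq : (1 : ℝ) ≤ p := by exact_mod_cast hp.one_le
  have hq1 : (1 : ℝ) < p := by exact_mod_cast hp.one_lt
  obtain ⟨D, hD1, hDreal, hDB⟩ := hC p hp.one_le
  have hD0 : (0 : ℝ) < D := by exact_mod_cast hD1
  obtain ⟨H, hH1, hH4, hH5, hHle, hHge⟩ := exists_nat_near_rpow_quarter hp.one_le hθ0 hθ1 hL4
  obtain ⟨M, hMlt, hMge, hMk⟩ := exists_nat_near_rpow_one_div hp.one_le hk1 hL3
  have hDH : DivisorBound (8 * H ^ 6) D := by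
    refine hDB.mono ?_
    calc 8 * H ^ 6 ≤ p * H ^ 8 :=
          Nat.mul_le_mul hp8 (Nat.pow_le_pow_right hH1 (by norm_num))
      _ = p * (H ^ 4) ^ 2 := by ring
      _ ≤ p * p ^ 2 := Nat.mul_le_mul_left _ (Nat.pow_le_pow_left hH4 2)
      _ = p ^ 3 := by ring
  have hint : ∀ i, 1 ≤ i → i ≤ 12 → ContainsInterval H (unitsIn (I i)) := by
    intro i hi1 hi2
    obtain ⟨g1, g2⟩ := hI i (Finset.mem_Icc.2 ⟨hi1, by omega⟩)
    refine containsInterval_unitsIn g1 g2 ?_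
    exact_mod_cast hHle.trans (hI12 i (Finset.mem_Icc.2 ⟨hi1, hi2⟩)).le
  have hDθ : (D : ℝ) ≤ C * (p : ℝ) ^ (θ / 12) := by
    refine hDreal.trans ?_
    gcongr
    rw [he, ← mul_div_assoc, div_le_div_iff₀ (by positivity) (by norm_num)]
    nlinarith
  have htriple : ∀ i, 1 ≤ i → i + 2 ≤ 12 → (p : ℝ) ^ (3 / 4 - θ) ≤
      ((unitsIn (I i) * unitsIn (I (i + 1)) * unitsIn (I (i + 2))).card : ℝ) := by
    intro i hi1 hi2
    exact rpow_le_of_pow_three_le hq hD0 hDθ hHge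
      (pow_three_le_card_mul_mul hH1 hH4 hH5 hDH (hint i hi1 (by omega))
        (hint (i + 1) (by omega) (by omega)) (hint (i + 2) (by omega) hi2)) hL1
  have hX₁ := htriple 1 (by norm_num) (by norm_num)
  have hX₂ := htriple 4 (by norm_num) (by norm_num)
  have hX₃ := htriple 7 (by norm_num) (by norm_num)
  have hY := htriple 10 (by norm_num) (by norm_num)
  norm_num only at hX₁ hX₂ hX₃ hY
  obtain ⟨g1, g2⟩ := hI 13 (by simp)
  have hMcard : M ≤ (I 13).ncard := by
    have : (M : ℝ) ≤ (I 13).ncard :=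
      (hMlt.le.trans (Real.rpow_le_rpow_of_exponent_le hq hkε)).trans hI13.le
    exact_mod_cast this
  have hJpow := pow_le_card_pow hMk (hDB.mono (Nat.le_self_pow (by norm_num) p)) (unitsIn (I 13))
    fun n hn1 hn2 => exists_mem_unitsIn g2 (natCast_mem_of_one_mem g1 g2 h1 hn1 (hn2.trans hMcard))
  have hDk : (D : ℝ) ≤ C * (p : ℝ) ^ (θ / (2 * k)) := by
    refine hDreal.trans ?_
    gcongr
    rw [he, ← mul_div_assoc, div_le_div_iff₀ (by positivity) (by positivity)]
    nlinarith [mul_pos hθ0 hk0]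
  have hJcard : (p : ℝ) ^ (1 - θ) ≤ ((unitsIn (I 13) ^ k).card : ℝ) :=
    rpow_le_of_pow_le_pow_mul hq hk1 hC1 hD0 hDk hMge (by exact_mod_cast hJpow) hL2
  have hY0 : (unitsIn (I 10) * unitsIn (I 11) * unitsIn (I 12)).Nonempty := by
    rw [← Finset.card_pos, ← Nat.cast_pos (α := ℝ)]
    exact lt_of_lt_of_le (Real.rpow_pos_of_pos (by linarith) _) hY
  have hYJ := rpow_le_of_pow_mul_le hq hk1 (Nat.cast_nonneg _) hJcard hY
    (by exact_mod_cast card_pow_mul_le_card_mul_pow _ (unitsIn (I 13)) hY0 hk1)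
  have hκ : 4 * θ < 1 / (4 * (k : ℝ)) := by
    rw [hθ, show 1 / (4 * (k : ℝ)) = 8 * (1 / (32 * k)) by field_simp; norm_num]
    linarith
  obtain ⟨x₁, hx₁, x₂, hx₂, x₃, hx₃, x₄, hx₄, heq⟩ :=
    exists_bilinear_eq ha hb hc _ _ _ _ (pow_three_lt_mul hq1 hκ hX₁ hX₂ hX₃ hYJ)
  exact mem_smul_prod_add_smul_prod hx₁ hx₂ hx₃ hx₄ heq
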